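/- Let $d\ge 1$ and let $(\varepsilon_j)_{j\in\mathbb{Z}^d}$ be independent, identically distributed random variables on a probability space, with values in a measurable space $E$; let $g:E^{\mathbb{Z}^d}\to\mathbb{R}$ be measurable, and set $X_i=g(\varepsilon_{i-s};\,s\in\mathbb{Z}^d)$ for $i\in\mathbb{Z}^d$. Assume that the (stationary) random field $(X_i)_{i\in\mathbb{Z}^d}$ satisfies $\mathbb{E}(X_i^2)<\infty$ and $\mathbb{E}(X_i)=0$. Let $(\varepsilon'_j)_{j\in\mathbb{Z}^d}$ be an independent copy of $(\varepsilon_j)_{j\in\mathbb{Z}^d}$, put $\varepsilon^*_0=\varepsilon'_0$ and $\varepsilon^*_j=\varepsilon_j$ for $j\ne0$, and let $X_i^*=g(\varepsilon^*_{i-s};\,s\in\mathbb{Z}^d)$. Define the physical dependence measure $\delta_{i,2}=\|X_i-X_i^*\|_{2}=(\mathbb{E}|X_i-X_i^*|^2)^{1/2}$ and assume $$\Delta_2:=\sum_{i\in\mathbb{Z}^d}\delta_{i,2}<\infty .$$ Let $(\Gamma_n)_{n\ge1}$ be any sequence of finite subsets of $\mathbb{Z}^d$ with $|\Gamma_n|\to\infty$,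 put $S_{\Gamma_n}=\sum_{i\in\Gamma_n}X_i$ and $\sigma_n^2=\mathbb{E}(S_{\Gamma_n}^2)$, and assume $\sigma_n^2\to\infty$. Then $$L\big[S_{\Gamma_n}/\sqrt{|\Gamma_n|},\;N(0,\sigma_n^2/|\Gamma_n|)\big]\longrightarrow 0\qquad(n\to\infty),$$ where $L$ denotes the Lévy distance between the laws, that is, for laws on $\mathbb{R}$ with distribution functions $F$ and $G$, $L=\inf\{r>0:\ F(x-r)-r\le G(x)\le F(x+r)+r\ \text{for all } x\in\mathbb{R}\}$. No condition is imposed on the boundary of $\Gamma_n$. -/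

import Mathlib

open MeasureTheory ProbabilityTheory Filter Topology
open scoped ENNReal

namespace RandomField

variable {d : ℕ} {Ω E : Type*} [MeasurableSpace Ω] [MeasurableSpace E]

/-- The family `ε` consists of independent and identically distributed random variables
with values in `E`. -/
def IsIID {ι : Type*} (ε : ι → Ω → E) (μ : Measure Ω) : Prop :=
  (∀ i, Measurable (ε i)) ∧ iIndepFun ε μ ∧ ∀ i j, IdentDistrib (ε i) (ε j) μ μ

/-- The family `ε'` is an independent copy of the family `ε`: as random elements of the product
space, the two families have the same law and are independent of each other. -/
def IsIndepCopy {ι : Type*} (ε ε' : ι → Ω → E) (μ : Measure Ω) : Prop :=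
  (∀ i, Measurable (ε' i)) ∧
    IdentDistrib (fun ω i => ε' i ω) (fun ω i => ε i ω) μ μ ∧
    IndepFun (fun ω i => ε i ω) (fun ω i => ε' i ω) μ

/-- The random field `X i = g (ε (i - s); s ∈ ℤ^d)` with input field `ε`. -/
def field (g : ((Fin d → ℤ) → E) → ℝ) (ε : (Fin d → ℤ) → Ω → E) (i : Fin d → ℤ) (ω : Ω) : ℝ :=
  g (fun s => ε (i - s) ω)

/-- The coupled input field: `ε` with the input at the origin replaced by that of `ε'`. -/
def coupledInput (ε ε' : (Fin d → ℤ) → Ω → E) : (Fin d → ℤ) → Ω → E :=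
  Function.update ε 0 (ε' 0)

/-- The physical dependence measure `δ_{i,p} = ‖X i - X* i‖_p`, as an extended nonnegative real. -/
noncomputable def physicalDependence (g : ((Fin d → ℤ) → E) → ℝ) (ε ε' : (Fin d → ℤ) → Ω → E)
    (p : ℝ≥0∞) (μ : Measure Ω) (i : Fin d → ℤ) : ℝ≥0∞ :=
  eLpNorm (fun ω => field g ε i ω - field g (coupledInput ε ε') i ω) p μ

/-- The partial sum `S_Γ = ∑_{i ∈ Γ} X i`. -/
def partialSum (X : (Fin d → ℤ) → Ω → ℝ) (Γ : Finset (Fin d → ℤ)) (ω : Ω) : ℝ :=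
  ∑ i ∈ Γ, X i ω

/-- The Lévy distance between two probability measures on the real line, through their
distribution functions. -/
noncomputable def levyDist (ν₁ ν₂ : Measure ℝ) : ℝ :=
  sInf {r : ℝ | 0 < r ∧ ∀ x : ℝ,
    cdf ν₁ (x - r) - r ≤ cdf ν₂ x ∧ cdf ν₂ x ≤ cdf ν₁ (x + r) + r}

end RandomField

/-!
The field lives on the product space of the inputs: `X i = f ∘ translate i` under `iidLaw ι ν`,
and the physical dependence measure is the family of influences of single coordinates on `f`
(`physicalDependence_eq_influence`), so the hypothesis says that `f` has finite total influence.

Everything rests on the Efron–Stein inequality `variance_le_tsum_influence_sq`. By Young's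
inequality for convolutions it yields `variance_sum_le`: the variance of a sum over `Γ` of
translates is at most `|Γ|` times the square of the total influence, with no condition on the shape
of `Γ`.

Consequently `f` may be replaced by a centred function `h` that is bounded, depends on finitely many
coordinates and has `f - h` of small total influence (`exists_bounded_local_approx_influence`); the
error in the normalized sums is small in `L²` uniformly over `Γ`. Such an `h` is obtained by
truncating `f` and averaging over all but finitely many coordinates, two operations that do not
increase influences; truncation is 1-Lipschitz, averaging is a contraction.

For `h` the central limit theorem is Stein's method for characteristic functions
(`exists_norm_charFun_siteSum_sub_le`). With `S` the sum over `Γ`, `V` its second moment and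
`χ` its characteristic function, `χ' (s) = i E[S exp (i s S)]`. Each summand is independent of the
part of `S` carried by far sites, so a Taylor expansion in the near part gives
`χ' (s) = -s E[W exp (i s S)]` up to an error of order `|Γ| s²`, where `W` is a sum of local
products with mean `V`; by `variance_sum_le` again, `W` may be replaced by `V` at a cost of order
`|s| √|Γ|`. Hence `χ` nearly solves the differential equation of `exp (-V s² / 2)`, and the errors
vanish after rescaling `s = t / √|Γ|`.

The variances `σ²/|Γ|` are bounded, so along subsequences they converge, and the Lévy
continuity theorem gives weak convergence of the laws of the normalized sums and of the Gaussian
laws to one and the same limit. Weak convergence is metrized by the Lévy–Prokhorov distance, which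
dominates the Lévy distance.
-/

namespace RandomField

/-! ### Product measures and splicing of configurations -/

lemma integral_comp_measurePreserving {α β G : Type*} [MeasurableSpace α] [MeasurableSpace β]
    [NormedAddCommGroup G] [NormedSpace ℝ G] {m : Measure α} {n : Measure β} {φ : α → β}
    (h : MeasurePreserving φ m n) {F : β → G} (hF : AEStronglyMeasurable F n) :
    ∫ x, F (φ x) ∂m = ∫ y, F y ∂n := by
  rw [← h.map_eq, integral_map h.aemeasurable (h.map_eq ▸ hF)]

section ProductSpace

variable {ι E : Type*}

open Classical in
/-- The configuration that agrees with `x` on `A` and with `y` off `A`. -/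
noncomputable def splice (A : Set ι) (x y : ι → E) : ι → E :=
  fun i => if i ∈ A then x i else y i

lemma splice_of_mem {A : Set ι} {x y : ι → E} {i : ι} (h : i ∈ A) : splice A x y i = x i := by
  simp [splice, h]

lemma splice_of_notMem {A : Set ι} {x y : ι → E} {i : ι} (h : i ∉ A) :
    splice A x y i = y i := by
  simp [splice, h]

lemma splice_insert_self (B : Set ι) (k : ι) (x y : ι → E) : splice (insert k B) x y k = x k :=
  splice_of_mem (Set.mem_insert k B)

lemma splice_insert_of_ne (B : Set ι) {k i : ι} (h : i ≠ k) (x y : ι → E) :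
    splice (insert k B) x y i = splice B x y i := by
  by_cases hi : i ∈ B
  · rw [splice_of_mem hi, splice_of_mem (Set.mem_insert_of_mem k hi)]
  · rw [splice_of_notMem hi, splice_of_notMem (by simp [h, hi])]

lemma splice_singleton_self (k : ι) (x y : ι → E) : splice {k} x y k = x k :=
  splice_of_mem rfl

lemma splice_singleton_of_ne {k i : ι} (h : i ≠ k) (x y : ι → E) : splice {k} x y i = y i :=
  splice_of_notMem h

variable [MeasurableSpace E]

@[fun_prop]
lemma measurable_splice {α : Type*} [MeasurableSpace α] {A : Set ι} {f g : α → ι → E}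
    (hf : Measurable f) (hg : Measurable g) : Measurable fun a => splice A (f a) (g a) := by
  refine measurable_pi_iff.2 fun i => ?_
  by_cases h : i ∈ A
  · simp only [splice_of_mem h]; fun_prop
  · simp only [splice_of_notMem h]; fun_prop

/-- The law of a family of independent variables indexed by `ι` with common law `ν`. -/
noncomputable abbrev iidLaw (ι : Type*) (ν : Measure E) : Measure (ι → E) :=
  Measure.infinitePi fun _ : ι => ν

/-- The law of a pair of independent families with law `iidLaw ι ν`. -/
noncomputable abbrev iidPair (ι : Type*) (ν : Measure E) : Measure ((ι → E) × (ι → E)) :=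
  (iidLaw ι ν).prod (iidLaw ι ν)

variable (ν : Measure E) [IsProbabilityMeasure ν]

lemma iidPair_pi_prod (S : Finset ι) {s t : ι → Set E} (hs : ∀ i, MeasurableSet (s i))
    (ht : ∀ i, MeasurableSet (t i)) :
    iidPair ι ν ((S : Set ι).pi s ×ˢ (S : Set ι).pi t) = ∏ i ∈ S, (ν (s i) * ν (t i)) := by
  rw [Measure.prod_prod, Measure.infinitePi_pi _ fun i _ => hs i,
    Measure.infinitePi_pi _ fun i _ => ht i, Finset.prod_mul_distrib]

/-- Exchanging the coordinates in `A` between two independent families preserves their joint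
law. -/
lemma measurePreserving_exchange (A : Set ι) :
    MeasurePreserving (fun p : (ι → E) × (ι → E) => (splice A p.2 p.1, splice A p.1 p.2))
      (iidPair ι ν) (iidPair ι ν) := by
  classical
  have hm : Measurable fun p : (ι → E) × (ι → E) => (splice A p.2 p.1, splice A p.1 p.2) := by
    fun_prop
  refine ⟨hm, Eq.symm ?_⟩
  have huniv : (Set.univ : Set (ι → E)) ∈
      squareCylinders (fun _ : ι => {s : Set E | MeasurableSet s}) :=
    ⟨∅, fun _ => Set.univ, by simp, by simp⟩
  have hpi : IsPiSystem (squareCylinders (fun _ : ι => {s : Set E | MeasurableSet s})) :=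
    isPiSystem_squareCylinders (fun _ => MeasurableSpace.isPiSystem_measurableSet) (by simp)
  let span : (iidLaw ι ν).FiniteSpanningSetsIn
      (squareCylinders (fun _ : ι => {s : Set E | MeasurableSet s})) :=
    ⟨fun _ => Set.univ, fun _ => huniv, fun _ => by simp, Set.iUnion_const _⟩
  refine Measure.prod_eq_generateFrom generateFrom_squareCylinders generateFrom_squareCylinders
    hpi hpi span span ?_
  rintro _ ⟨S, s, hs, rfl⟩ _ ⟨T, t, ht, rfl⟩
  replace hs : ∀ i, MeasurableSet (s i) := fun i => hs i trivial
  replace ht : ∀ i, MeasurableSet (t i) := fun i => ht i trivial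
  -- Write both boxes over the common index set `S ∪ T`.
  set s' : ι → Set E := fun i => if i ∈ S then s i else Set.univ with hs'
  set t' : ι → Set E := fun i => if i ∈ T then t i else Set.univ with ht'
  have hs'm : ∀ i, MeasurableSet (s' i) := fun i => by
    simp only [hs']; split_ifs <;> simp [hs]
  have ht'm : ∀ i, MeasurableSet (t' i) := fun i => by
    simp only [ht']; split_ifs <;> simp [ht]
  have eS : (S : Set ι).pi s = ((S ∪ T : Finset ι) : Set ι).pi s' := by
    ext x; simp only [Set.mem_pi, hs']; grind
  have eT : (T : Set ι).pi t = ((S ∪ T : Finset ι) : Set ι).pi t' := by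
    ext x; simp only [Set.mem_pi, ht']; grind
  have hpre : (fun p : (ι → E) × (ι → E) => (splice A p.2 p.1, splice A p.1 p.2)) ⁻¹'
      ((((S ∪ T : Finset ι) : Set ι).pi s') ×ˢ (((S ∪ T : Finset ι) : Set ι).pi t')) =
      (((S ∪ T : Finset ι) : Set ι).pi fun i => if i ∈ A then t' i else s' i) ×ˢ
      (((S ∪ T : Finset ι) : Set ι).pi fun i => if i ∈ A then s' i else t' i) := by
    ext ⟨x, y⟩
    simp only [Set.mem_preimage, Set.mem_prod, Set.mem_pi, splice]
    constructor
    · rintro ⟨h1, h2⟩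
      refine ⟨fun i hi => ?_, fun i hi => ?_⟩ <;> specialize h1 i hi <;> specialize h2 i hi <;>
        split_ifs at * <;> assumption
    · rintro ⟨h1, h2⟩
      refine ⟨fun i hi => ?_, fun i hi => ?_⟩ <;> specialize h1 i hi <;> specialize h2 i hi <;>
        split_ifs at * <;> assumption
  have hms : MeasurableSet ((((S ∪ T : Finset ι) : Set ι).pi s') ×ˢ
      (((S ∪ T : Finset ι) : Set ι).pi t')) :=
    (MeasurableSet.pi (Finset.countable_toSet _) fun i _ => hs'm i).prod
      (MeasurableSet.pi (Finset.countable_toSet _) fun i _ => ht'm i)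
  rw [eS, eT, Measure.map_apply hm hms, hpre, iidPair_pi_prod, ← Measure.prod_prod,
    iidPair_pi_prod ν _ hs'm ht'm]
  · refine Finset.prod_congr rfl fun i _ => ?_
    split_ifs
    · rw [mul_comm]
    · rfl
  · intro i; split_ifs <;> simp [hs'm, ht'm]
  · intro i; split_ifs <;> simp [hs'm, ht'm]

lemma measurePreserving_splice (A : Set ι) :
    MeasurePreserving (fun p : (ι → E) × (ι → E) => splice A p.2 p.1)
      (iidPair ι ν) (iidLaw ι ν) :=
  measurePreserving_fst.comp (measurePreserving_exchange ν A)

/-- Functions of disjoint sets of coordinates are independent under a product measure; here the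
resulting factorization of the integral of their product. -/
lemma integral_mul_of_dependsOn {L : Type*} [RCLike L] {F G : (ι → E) → L} {A : Set ι}
    (hF : Measurable F) (hG : Measurable G) (hFA : DependsOn F A) (hGA : DependsOn G Aᶜ) :
    ∫ x, F x * G x ∂iidLaw ι ν = (∫ x, F x ∂iidLaw ι ν) * ∫ x, G x ∂iidLaw ι ν := by
  have h := measurePreserving_splice (E := E) (ι := ι) ν Aᶜ
  rw [← integral_prod_mul, ← integral_comp_measurePreserving h (F := fun x => F x * G x)
    (hF.mul hG).aestronglyMeasurable]
  refine integral_congr_ae (.of_forall fun p => ?_)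
  dsimp only
  congr 1
  · exact hFA fun i hi => splice_of_notMem (by simpa using hi)
  · exact hGA fun i hi => splice_of_mem hi

end ProductSpace

lemma eLpNorm_two_sq {α G : Type*} [MeasurableSpace α] [NormedAddCommGroup G] {m : Measure α}
    (f : α → G) : eLpNorm f 2 m ^ 2 = ∫⁻ x, ‖f x‖ₑ ^ 2 ∂m := by
  have := eLpNorm_nnreal_pow_eq_lintegral (f := f) (μ := m) (p := 2) two_ne_zero
  simpa using this

/-- The Cauchy–Schwarz inequality. -/
lemma abs_integral_mul_le {α : Type*} [MeasurableSpace α] {m : Measure α} {f g : α → ℝ}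
    (hf : MemLp f 2 m) (hg : MemLp g 2 m) :
    |∫ x, f x * g x ∂m| ≤ (eLpNorm f 2 m).toReal * (eLpNorm g 2 m).toReal := by
  have h1 : eLpNorm (f • g) 1 m ≤ eLpNorm f 2 m * eLpNorm g 2 m :=
    eLpNorm_smul_le_mul_eLpNorm hg.1 hf.1
  have hfin : eLpNorm f 2 m * eLpNorm g 2 m ≠ ∞ := ENNReal.mul_ne_top hf.2.ne hg.2.ne
  rw [← ENNReal.toReal_mul]
  refine le_trans ?_ (ENNReal.toReal_mono hfin h1)
  rw [eLpNorm_one_eq_lintegral_enorm]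
  refine (norm_integral_le_lintegral_norm fun x => f x * g x).trans (le_of_eq ?_)
  simp_rw [ofReal_norm]
  rfl

/-! ### Influences of coordinates and resampling -/

section EfronStein

variable {ι E : Type*} [MeasurableSpace E] (ν : Measure E)

/-- The influence of the coordinate `k` on `F`: the `L²` distance between `F` and the function
obtained from `F` by resampling the coordinate `k`. -/
noncomputable def influence (F : (ι → E) → ℝ) (k : ι) : ℝ≥0∞ :=
  eLpNorm (fun p : (ι → E) × (ι → E) => F p.1 - F (splice {k} p.2 p.1)) 2 (iidPair ι ν)

variable {ν} {F : (ι → E) → ℝ}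

lemma influence_eq_zero_of_dependsOn {A : Set ι} (hF : DependsOn F A) {k : ι} (hk : k ∉ A) :
    influence ν F k = 0 := by
  have : ∀ p : (ι → E) × (ι → E), F p.1 - F (splice {k} p.2 p.1) = 0 := by
    intro p
    rw [sub_eq_zero]
    refine hF fun i hi => (splice_singleton_of_ne ?_ _ _).symm
    rintro rfl
    exact hk hi
  simp [influence, this]

lemma influence_sub_const (c : ℝ) (k : ι) :
    influence ν (fun x => F x - c) k = influence ν F k := by
  simp [influence]

variable [IsProbabilityMeasure ν]

lemma memLp_splice (hF : MemLp F 2 (iidLaw ι ν)) (A : Set ι) :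
    MemLp (fun p : (ι → E) × (ι → E) => F (splice A p.2 p.1)) 2 (iidPair ι ν) :=
  hF.comp_measurePreserving (measurePreserving_splice ν A)

lemma memLp_comp_fst (hF : MemLp F 2 (iidLaw ι ν)) :
    MemLp (fun p : (ι → E) × (ι → E) => F p.1) 2 (iidPair ι ν) :=
  hF.comp_measurePreserving measurePreserving_fst

lemma memLp_comp_snd (hF : MemLp F 2 (iidLaw ι ν)) :
    MemLp (fun p : (ι → E) × (ι → E) => F p.2) 2 (iidPair ι ν) :=
  hF.comp_measurePreserving measurePreserving_snd

lemma eLpNorm_comp_fst (hF : AEStronglyMeasurable F (iidLaw ι ν)) :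
    eLpNorm (fun p : (ι → E) × (ι → E) => F p.1) 2 (iidPair ι ν) = eLpNorm F 2 (iidLaw ι ν) :=
  eLpNorm_comp_measurePreserving hF measurePreserving_fst

lemma influence_lt_top (hF : MemLp F 2 (iidLaw ι ν)) (k : ι) : influence ν F k < ∞ :=
  ((memLp_comp_fst hF).sub (memLp_splice hF {k})).2

lemma influence_le_two_mul (hF : MemLp F 2 (iidLaw ι ν)) (k : ι) :
    influence ν F k ≤ 2 * eLpNorm F 2 (iidLaw ι ν) := by
  refine (eLpNorm_sub_le (memLp_comp_fst hF).1 (memLp_splice hF {k}).1 (by norm_num)).trans ?_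
  rw [eLpNorm_comp_fst hF.1, two_mul]
  exact add_le_add le_rfl
    (eLpNorm_comp_measurePreserving hF.1 (measurePreserving_splice ν {k})).le

lemma influence_le_of_abs_le {c : ℝ} (hF : Measurable F) (hc : ∀ x, |F x| ≤ c) (k : ι) :
    influence ν F k ≤ 2 * ENNReal.ofReal c := by
  have h2 : MemLp F 2 (iidLaw ι ν) := .of_bound hF.aestronglyMeasurable c (.of_forall hc)
  refine (influence_le_two_mul h2 k).trans (mul_le_mul_right ?_ 2)
  simpa using eLpNorm_le_of_ae_bound (p := 2) (μ := iidLaw ι ν) (.of_forall hc)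

lemma influence_sum_le {κ : Type*} {Γ : Finset κ} {f : κ → (ι → E) → ℝ}
    (hf : ∀ i ∈ Γ, MemLp (f i) 2 (iidLaw ι ν)) (k : ι) :
    influence ν (fun x => ∑ i ∈ Γ, f i x) k ≤ ∑ i ∈ Γ, influence ν (f i) k := by
  refine le_trans (le_of_eq ?_) (eLpNorm_sum_le (fun i hi =>
    ((memLp_comp_fst (hf i hi)).sub (memLp_splice (hf i hi) {k})).1) (by norm_num))
  refine congrArg (eLpNorm · 2 _) (funext fun p => ?_)
  simp [Finset.sum_apply]

lemma influence_sub_le {f h : (ι → E) → ℝ} (hf : MemLp f 2 (iidLaw ι ν))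
    (hh : MemLp h 2 (iidLaw ι ν)) (k : ι) :
    influence ν (fun x => f x - h x) k ≤ influence ν f k + influence ν h k := by
  refine le_trans (le_of_eq ?_) (eLpNorm_sub_le ((memLp_comp_fst hf).sub (memLp_splice hf {k})).1
    ((memLp_comp_fst hh).sub (memLp_splice hh {k})).1 (by norm_num))
  refine congrArg (eLpNorm · 2 _) (funext fun p => ?_)
  simp only [Pi.sub_apply]; ring

/-- Replacing one more coordinate in an already partially resampled configuration changes `F` by
the influence of that coordinate. -/
lemma eLpNorm_splice_sub_splice_insert (hF : MemLp F 2 (iidLaw ι ν)) {B : Set ι} {k : ι}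
    (hk : k ∉ B) :
    eLpNorm (fun p : (ι → E) × (ι → E) => F (splice B p.2 p.1) - F (splice (insert k B) p.2 p.1))
      2 (iidPair ι ν) = influence ν F k := by
  rw [influence, ← eLpNorm_comp_measurePreserving (p := 2)
    (g := fun p : (ι → E) × (ι → E) => F p.1 - F (splice {k} p.2 p.1))
    ((memLp_comp_fst hF).sub (memLp_splice hF {k})).1 (measurePreserving_exchange (E := E) ν B)]
  refine congrArg (eLpNorm · 2 _) (funext fun p => ?_)
  simp only [Function.comp_apply]
  congr 2
  funext i
  by_cases h1 : i = k
  · subst h1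
    rw [splice_singleton_self, splice_insert_self, splice_of_notMem hk]
  · rw [splice_singleton_of_ne h1, splice_insert_of_ne B h1]

/-- The key step of the Efron–Stein inequality. By antisymmetry under the exchange of the coordinate
`k`, the factor `F p.1` may be replaced by half of its own increment under resampling of `k`. -/
lemma integral_mul_splice_sub_le (hF : MemLp F 2 (iidLaw ι ν)) {B : Set ι} {k : ι}
    (hk : k ∉ B) :
    ∫ p : (ι → E) × (ι → E), F p.1 * (F (splice B p.2 p.1) - F (splice (insert k B) p.2 p.1))
      ∂iidPair ι ν ≤ (influence ν F k).toReal ^ 2 := by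
  set D : (ι → E) × (ι → E) → ℝ :=
    fun p => F (splice B p.2 p.1) - F (splice (insert k B) p.2 p.1) with hD
  have hDm : MemLp D 2 (iidPair ι ν) := (memLp_splice hF B).sub (memLp_splice hF (insert k B))
  have h1 := memLp_comp_fst hF
  have hk1 := memLp_splice hF {k}
  -- Exchanging the coordinate `k` changes the sign of `D`.
  have hswap : ∫ p, F p.1 * D p ∂iidPair ι ν
      = - ∫ p : (ι → E) × (ι → E), F (splice {k} p.2 p.1) * D p ∂iidPair ι ν := by
    have := integral_comp_measurePreserving (measurePreserving_exchange (E := E) ν {k})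
      (F := fun p => F p.1 * D p) (h1.1.mul hDm.1)
    rw [← this, ← integral_neg]
    refine integral_congr_ae (.of_forall fun p => ?_)
    simp only [hD]
    have e1 : splice B (splice {k} p.1 p.2) (splice {k} p.2 p.1) = splice (insert k B) p.2 p.1 := by
      funext i
      by_cases h1 : i = k
      · subst h1
        rw [splice_of_notMem hk, splice_singleton_self, splice_insert_self]
      · rw [splice_insert_of_ne B h1]
        simp only [splice, Set.mem_singleton_iff, h1, if_false]
    have e2 : splice (insert k B) (splice {k} p.1 p.2) (splice {k} p.2 p.1)
        = splice B p.2 p.1 := by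
      funext i
      by_cases h1 : i = k
      · subst h1
        rw [splice_of_notMem hk, splice_insert_self, splice_singleton_self]
      · rw [splice_insert_of_ne B h1]
        simp only [splice, Set.mem_singleton_iff, h1, if_false]
    rw [e1, e2]; ring
  have hhalf : 2 * ∫ p, F p.1 * D p ∂iidPair ι ν
      = ∫ p : (ι → E) × (ι → E), (F p.1 - F (splice {k} p.2 p.1)) * D p ∂iidPair ι ν := by
    have i1 : Integrable (fun p => F p.1 * D p) (iidPair ι ν) := h1.integrable_mul hDm
    have i2 : Integrable (fun p => F (splice {k} p.2 p.1) * D p) (iidPair ι ν) :=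
      hk1.integrable_mul hDm
    simp_rw [sub_mul]
    rw [integral_sub i1 i2]
    linarith
  have hb := (le_abs_self _).trans (abs_integral_mul_le (h1.sub hk1) hDm)
  have e : eLpNorm D 2 (iidPair ι ν) = influence ν F k := eLpNorm_splice_sub_splice_insert hF hk
  have hb' : ∫ p : (ι → E) × (ι → E), (F p.1 - F (splice {k} p.2 p.1)) * D p ∂iidPair ι ν ≤
      (influence ν F k).toReal * (influence ν F k).toReal := by
    rw [e] at hb; exact hb
  nlinarith [sq_nonneg (influence ν F k).toReal]

/-- Resampling the coordinates of `A` one at a time. -/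
lemma integral_mul_sub_splice_le (hF : MemLp F 2 (iidLaw ι ν)) (A : Finset ι) :
    ∫ p : (ι → E) × (ι → E), F p.1 * (F p.1 - F (splice A p.2 p.1)) ∂iidPair ι ν
      ≤ ∑ k ∈ A, (influence ν F k).toReal ^ 2 := by
  classical
  induction A using Finset.induction_on with
  | empty =>
    have h0 : ∀ x y : ι → E, splice ∅ x y = y := fun x y => funext fun i => by simp [splice]
    simp [h0]
  | insert k A hk ih =>
    have h := integral_mul_splice_sub_le hF (B := (A : Set ι)) (k := k) (by simpa using hk)
    have h1 := memLp_comp_fst hF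
    have hs : ∫ p : (ι → E) × (ι → E),
        F p.1 * (F p.1 - F (splice ((insert k A : Finset ι) : Set ι) p.2 p.1)) ∂iidPair ι ν =
        (∫ p : (ι → E) × (ι → E), F p.1 * (F p.1 - F (splice A p.2 p.1)) ∂iidPair ι ν) +
        ∫ p : (ι → E) × (ι → E), F p.1 *
          (F (splice A p.2 p.1) - F (splice (insert k (A : Set ι)) p.2 p.1)) ∂iidPair ι ν := by
      have i1 : Integrable (fun p : (ι → E) × (ι → E) =>
          F p.1 * (F p.1 - F (splice A p.2 p.1))) (iidPair ι ν) :=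
        h1.integrable_mul (h1.sub (memLp_splice hF A))
      have i2 : Integrable (fun p : (ι → E) × (ι → E) => F p.1 *
          (F (splice A p.2 p.1) - F (splice (insert k (A : Set ι)) p.2 p.1))) (iidPair ι ν) :=
        h1.integrable_mul ((memLp_splice hF A).sub (memLp_splice hF (insert k (A : Set ι))))
      rw [← integral_add i1 i2]
      refine integral_congr_ae (.of_forall fun p => ?_)
      simp only [Finset.coe_insert]
      ring
    rw [hs, Finset.sum_insert hk]
    linarith

end EfronStein

/-! ### The Efron–Stein inequality and density of local functions -/

section LocalFunctions

variable {ι E : Type*} [MeasurableSpace E]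

lemma dependsOn_of_stronglyMeasurable_cylinderEvents {A : Set ι} {f : (ι → E) → ℝ}
    (hf : StronglyMeasurable[cylinderEvents (X := fun _ : ι => E) A] f) : DependsOn f A := by
  have hle : cylinderEvents (X := fun _ : ι => E) A ≤
      MeasurableSpace.comap (A.domRestrict) MeasurableSpace.pi := by
    refine iSup₂_le fun i hi => ?_
    rintro _ ⟨s, hs, rfl⟩
    exact ⟨(fun x : A → E => x ⟨i, hi⟩) ⁻¹' s, measurable_pi_apply _ hs, rfl⟩
  intro x y hxy
  have hm :
      Measurable[MeasurableSpace.comap (A.domRestrict (π := fun _ => E)) MeasurableSpace.pi] f :=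
    (hf.measurable).mono hle le_rfl
  obtain ⟨s, -, hs⟩ := hm (measurableSet_singleton (f x))
  have hx : x ∈ (A.domRestrict (π := fun _ => E)) ⁻¹' s := by rw [hs]; simp
  have hxy' : A.domRestrict x = A.domRestrict y := by
    funext i; exact hxy i i.2
  have hy : y ∈ (A.domRestrict (π := fun _ => E)) ⁻¹' s := by
    rw [Set.mem_preimage, ← hxy']; exact hx
  rw [hs] at hy
  exact (by simpa using hy : f y = f x).symm

/-- Truncation of a real number to the interval `[-M, M]`. -/
noncomputable def clamp (M x : ℝ) : ℝ := max (-M) (min M x)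

lemma abs_clamp_le {M : ℝ} (hM : 0 ≤ M) (x : ℝ) : |clamp M x| ≤ M := by
  rw [clamp, abs_le]; constructor
  · exact le_max_left _ _
  · exact max_le (by linarith) (min_le_left _ _)

lemma abs_clamp_sub_clamp_le (M x y : ℝ) : |clamp M x - clamp M y| ≤ |x - y| := by
  unfold clamp
  refine (abs_max_sub_max_le_max _ _ _ _).trans (max_le (by simp) ?_)
  exact (abs_min_sub_min_le_max _ _ _ _).trans (max_le (by simp) le_rfl)

@[fun_prop]
lemma measurable_clamp (M : ℝ) : Measurable (clamp M) := by
  unfold clamp; fun_prop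

lemma exists_clamp_approx {α : Type*} [MeasurableSpace α] {m : Measure α} {f : α → ℝ}
    (hfm : Measurable f) (hf : MemLp f 2 m) {ρ : ℝ} (hρ : 0 < ρ) :
    ∃ M, 0 ≤ M ∧ eLpNorm (fun x => f x - clamp M (f x)) 2 m ≤ ENNReal.ofReal ρ := by
  obtain ⟨M, hM⟩ := hf.eLpNorm_indicator_norm_ge_le hfm.stronglyMeasurable hρ
  refine ⟨max M 0, le_max_right _ _, (eLpNorm_mono fun x => ?_).trans hM⟩
  by_cases h : M ≤ |f x|
  · rw [Set.indicator_of_mem (by exact h), Real.norm_eq_abs, Real.norm_eq_abs]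
    unfold clamp
    rcases max_cases (-(max M 0)) (min (max M 0) (f x)) with h1 | h1 <;>
    rcases min_cases (max M 0) (f x) with h2 | h2 <;>
    rcases max_cases M 0 with h3 | h3 <;>
    rw [abs_le] <;> constructor <;> rcases abs_cases (f x) with h4 | h4 <;> linarith
  · rw [Set.indicator_of_notMem (by exact h), norm_zero]
    rw [not_le, abs_lt] at h
    unfold clamp
    rw [min_eq_right (h.2.le.trans (le_max_left _ _)), max_eq_right]
    · simp
    · linarith [le_max_left M 0]

variable (ν : Measure E) [IsProbabilityMeasure ν]

/-- Functions of finitely many coordinates are dense in `L²`. -/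
lemma exists_dependsOn_finset_approx [Countable ι] {F : (ι → E) → ℝ} (hFm : Measurable F)
    (hF : MemLp F 2 (iidLaw ι ν)) {ρ : ℝ} (hρ : 0 < ρ) :
    ∃ (A : Finset ι) (F' : (ι → E) → ℝ), DependsOn F' A ∧ Measurable F' ∧
      MemLp F' 2 (iidLaw ι ν) ∧
      eLpNorm (fun x => F x - F' x) 2 (iidLaw ι ν) ≤ ENNReal.ofReal ρ := by
  obtain ⟨e, he⟩ := Countable.exists_injective_nat ι
  obtain ⟨M, hM0, hM⟩ := exists_clamp_approx hFm hF (half_pos hρ)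
  set G : (ι → E) → ℝ := fun x => clamp M (F x) with hG
  have hGm : Measurable G := (measurable_clamp M).comp hFm
  have hGb : ∀ x, |G x| ≤ M := fun x => abs_clamp_le hM0 _
  have hG2 : MemLp G 2 (iidLaw ι ν) := .of_bound hGm.aestronglyMeasurable M (.of_forall hGb)
  let ℱ : Filtration ℕ (MeasurableSpace.pi : MeasurableSpace (ι → E)) :=
    { seq := fun n => cylinderEvents {i | e i < n}
      mono' := fun m n hmn => cylinderEvents_mono fun i (hi : e i < m) => hi.trans_le hmn
      le' := fun n => cylinderEvents_le_pi }
  have hsup : (MeasurableSpace.pi : MeasurableSpace (ι → E)) ≤ ⨆ n, ℱ n := by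
    refine iSup_le fun i => le_trans ?_ (le_iSup _ (e i + 1))
    exact le_iSup₂_of_le (f := fun j (_ : j ∈ {j | e j < e i + 1}) =>
      MeasurableSpace.comap (fun σ : ι → E => σ j) _) i (Nat.lt_succ_self _) le_rfl
  have hlim := (hG2.integrable one_le_two).tendsto_eLpNorm_condExp (ℱ := ℱ)
    (hGm.mono hsup le_rfl).stronglyMeasurable
  -- The martingale converges in `L¹`; since it is bounded by `M`, it also converges in `L²`.
  have hbound : ∀ n, eLpNorm ((iidLaw ι ν)[G | ℱ n] - G) 2 (iidLaw ι ν) ^ 2 ≤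
      ENNReal.ofReal (2 * M) * eLpNorm ((iidLaw ι ν)[G | ℱ n] - G) 1 (iidLaw ι ν) := by
    intro n
    have hb := ae_bdd_abs_condExp_of_ae_bdd_abs (m := ℱ n) (μ := iidLaw ι ν) (R := M) (f := G)
      (.of_forall hGb)
    rw [eLpNorm_one_eq_lintegral_enorm, ← lintegral_const_mul' _ _ ENNReal.ofReal_ne_top]
    have : eLpNorm ((iidLaw ι ν)[G | ℱ n] - G) 2 (iidLaw ι ν) ^ 2 =
        ∫⁻ x, ‖((iidLaw ι ν)[G | ℱ n] - G) x‖ₑ ^ 2 ∂iidLaw ι ν := eLpNorm_two_sq _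
    rw [this]
    refine lintegral_mono_ae (hb.mono fun x hx => ?_)
    rw [sq]
    gcongr
    rw [← ofReal_norm]
    refine ENNReal.ofReal_le_ofReal ((norm_sub_le _ _).trans ?_)
    have := hGb x
    simp only [Real.norm_eq_abs] 
    have hx' : |((iidLaw ι ν)[G | ℱ n]) x| ≤ M := hx
    linarith
  have hlim2 : Tendsto (fun n => ENNReal.ofReal (2 * M) *
      eLpNorm ((iidLaw ι ν)[G | ℱ n] - G) 1 (iidLaw ι ν)) atTop (𝓝 0) := by
    have := ENNReal.Tendsto.const_mul hlim (a := ENNReal.ofReal (2 * M))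
      (Or.inr ENNReal.ofReal_ne_top)
    rwa [mul_zero] at this
  have hpos : (0 : ℝ≥0∞) < ENNReal.ofReal (ρ / 2) ^ 2 := by
    have : 0 < ENNReal.ofReal (ρ / 2) := by simpa using half_pos hρ
    positivity
  obtain ⟨n, hn⟩ := (hlim2.eventually_lt_const hpos).exists
  have hn2 : eLpNorm ((iidLaw ι ν)[G | ℱ n] - G) 2 (iidLaw ι ν) ≤ ENNReal.ofReal (ρ / 2) := by
    by_contra! hlt
    exact absurd ((hbound n).trans_lt hn) (not_lt.2 (by gcongr))
  have hfin : {i | e i < n}.Finite := (Set.finite_lt_nat n).preimage he.injOn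
  have hF'2 : MemLp ((iidLaw ι ν)[G | ℱ n]) 2 (iidLaw ι ν) := hG2.condExp one_le_two
  refine ⟨hfin.toFinset, (iidLaw ι ν)[G | ℱ n], ?_,
    (stronglyMeasurable_condExp.mono (ℱ.le n)).measurable, hF'2, ?_⟩
  · rw [hfin.coe_toFinset]
    exact dependsOn_of_stronglyMeasurable_cylinderEvents stronglyMeasurable_condExp
  · have e1 : (fun x => F x - ((iidLaw ι ν)[G | ℱ n]) x) =
        (fun x => F x - G x) - ((iidLaw ι ν)[G | ℱ n] - G) := by
      funext x; simp
    rw [e1]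
    refine (eLpNorm_sub_le (hF.sub hG2).1 (hF'2.sub hG2).1 (by norm_num)).trans ?_
    refine (add_le_add hM hn2).trans ?_
    rw [← ENNReal.ofReal_add (by positivity) (by positivity)]
    simp

variable {ν}

/-- The **Efron–Stein inequality** for square-integrable functions of countably many independent
variables, without the optimal factor `1 / 2`. -/
lemma variance_le_tsum_influence_sq [Countable ι] {F : (ι → E) → ℝ} (hFm : Measurable F)
    (hF : MemLp F 2 (iidLaw ι ν)) :
    ENNReal.ofReal (Var[F; iidLaw ι ν]) ≤ ∑' k, influence ν F k ^ 2 := by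
  refine ENNReal.le_of_forall_pos_le_add fun η hη _ => ?_
  set N := (eLpNorm F 2 (iidLaw ι ν)).toReal with hN
  have hN0 : 0 ≤ N := ENNReal.toReal_nonneg
  set ρ : ℝ := η / (2 * (N + 1)) with hρ
  have hρ0 : 0 < ρ := by positivity
  obtain ⟨A, F', hF'A, -, hF'2, hF'ρ⟩ := exists_dependsOn_finset_approx ν hFm hF hρ0
  have h1 := memLp_comp_fst hF
  have h2 := memLp_comp_snd hF
  have hA := memLp_splice hF A
  have hvar : Var[F; iidLaw ι ν] =
      (∫ p : (ι → E) × (ι → E), F p.1 * (F p.1 - F (splice A p.2 p.1)) ∂iidPair ι ν) +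
      ∫ p : (ι → E) × (ι → E), F p.1 * (F (splice A p.2 p.1) - F p.2) ∂iidPair ι ν := by
    have i1 : Integrable (fun p : (ι → E) × (ι → E) =>
        F p.1 * (F p.1 - F (splice A p.2 p.1))) (iidPair ι ν) := h1.integrable_mul (h1.sub hA)
    have i2 : Integrable (fun p : (ι → E) × (ι → E) =>
        F p.1 * (F (splice A p.2 p.1) - F p.2)) (iidPair ι ν) := h1.integrable_mul (hA.sub h2)
    have i3 : Integrable (fun p : (ι → E) × (ι → E) => F p.1 ^ 2) (iidPair ι ν) :=
      h1.integrable_sq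
    have i4 : Integrable (fun p : (ι → E) × (ι → E) => F p.1 * F p.2) (iidPair ι ν) :=
      h1.integrable_mul h2
    have e : ∫ x, (F ^ 2) x ∂iidLaw ι ν = ∫ p : (ι → E) × (ι → E), F p.1 ^ 2 ∂iidPair ι ν :=
      (integral_comp_measurePreserving measurePreserving_fst hF.integrable_sq.1).symm
    rw [← integral_add i1 i2, variance_eq_sub hF, e, sq (∫ x, F x ∂iidLaw ι ν),
      ← integral_prod_mul, ← integral_sub i3 i4]
    refine integral_congr_ae (.of_forall fun p => ?_)
    dsimp only
    ring
  have hlocal := integral_mul_sub_splice_le hF A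
  -- `F'` takes the same value at `splice A y x` and at `y`, so only `F - F'` matters here.
  have hrem : ∫ p : (ι → E) × (ι → E), F p.1 * (F (splice A p.2 p.1) - F p.2) ∂iidPair ι ν
      ≤ N * (2 * ρ) := by
    refine (le_abs_self _).trans ((abs_integral_mul_le h1 (hA.sub h2)).trans ?_)
    rw [eLpNorm_comp_fst hF.1]
    refine mul_le_mul_of_nonneg_left (ENNReal.toReal_le_of_le_ofReal (by positivity) ?_) hN0
    have hd : MemLp (fun x => F x - F' x) 2 (iidLaw ι ν) := hF.sub hF'2
    have e : ((fun p : (ι → E) × (ι → E) => F (splice A p.2 p.1)) - fun p => F p.2) =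
        (fun p => F (splice A p.2 p.1) - F' (splice A p.2 p.1)) - fun p => F p.2 - F' p.2 := by
      funext p
      have : F' (splice A p.2 p.1) = F' p.2 := hF'A fun i hi => splice_of_mem hi
      simp only [Pi.sub_apply, this]
      ring
    rw [e]
    refine (eLpNorm_sub_le (memLp_splice hd A).1 (memLp_comp_snd hd).1 (by norm_num)).trans ?_
    have e1 := eLpNorm_comp_measurePreserving (p := 2) hd.1
      (measurePreserving_splice (E := E) ν (A : Set ι))
    have e2 : eLpNorm ((fun x => F x - F' x) ∘ Prod.snd) 2 (iidPair ι ν) = _ :=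
      eLpNorm_comp_measurePreserving (p := 2) hd.1 measurePreserving_snd
    rw [two_mul, ENNReal.ofReal_add hρ0.le hρ0.le]
    exact add_le_add (e1.trans_le hF'ρ) (e2.trans_le hF'ρ)
  have hsmall : N * (2 * ρ) ≤ η := by
    rw [hρ, mul_div_assoc', mul_div_assoc', div_le_iff₀ (by positivity)]
    nlinarith [η.2]
  have hfin : Var[F; iidLaw ι ν] ≤ ∑ k ∈ A, (influence ν F k).toReal ^ 2 + η := by linarith
  refine (ENNReal.ofReal_le_ofReal hfin).trans ?_
  have hsum : 0 ≤ ∑ k ∈ A, (influence ν F k).toReal ^ 2 :=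
    Finset.sum_nonneg fun k _ => sq_nonneg _
  rw [ENNReal.ofReal_add hsum η.coe_nonneg, ENNReal.ofReal_coe_nnreal]
  refine add_le_add ?_ le_rfl
  refine le_trans (le_of_eq ?_) (ENNReal.sum_le_tsum A)
  rw [ENNReal.ofReal_sum_of_nonneg fun k _ => sq_nonneg _]
  refine Finset.sum_congr rfl fun k _ => ?_
  rw [ENNReal.ofReal_pow ENNReal.toReal_nonneg, ENNReal.ofReal_toReal (influence_lt_top hF k).ne]

end LocalFunctions

/-! ### Approximation by bounded local functions -/

section LocalApproximation

/-- Jensen's inequality for averages with respect to a probability measure: averaging out one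
variable does not increase the `L²` norm. -/
lemma eLpNorm_integral_prod_le {X Z : Type*} [MeasurableSpace X] [MeasurableSpace Z]
    {m : Measure X} {n : Measure Z} [IsProbabilityMeasure n] {K : X × Z → ℝ}
    (hK : Measurable K) :
    eLpNorm (fun x => ∫ z, K (x, z) ∂n) 2 m ≤ eLpNorm K 2 (m.prod n) := by
  refine (ENNReal.pow_le_pow_left_iff two_ne_zero).1 ?_
  rw [eLpNorm_two_sq, eLpNorm_two_sq, lintegral_prod _ (by fun_prop)]
  refine lintegral_mono fun x => ?_
  have hx : AEStronglyMeasurable (fun z => K (x, z)) n :=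
    (hK.comp measurable_prodMk_left).aestronglyMeasurable
  rw [← eLpNorm_two_sq fun z => K (x, z)]
  gcongr
  refine (enorm_integral_le_lintegral_enorm _).trans ?_
  rw [← eLpNorm_one_eq_lintegral_enorm]
  exact eLpNorm_le_eLpNorm_of_exponent_le one_le_two hx

variable {ι E : Type*} [MeasurableSpace E] {ν : Measure E}

variable (ν) in
/-- The function of the coordinates in `A` obtained from `F` by averaging over the other
coordinates: a version of the conditional expectation of `F` given the coordinates in `A`. -/
noncomputable def coordAverage (A : Set ι) (F : (ι → E) → ℝ) (x : ι → E) : ℝ :=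
  ∫ y, F (splice A x y) ∂iidLaw ι ν

lemma dependsOn_coordAverage (A : Set ι) (F : (ι → E) → ℝ) :
    DependsOn (coordAverage ν A F) A := by
  intro x y hxy
  unfold coordAverage
  congr 1
  funext z
  congr 1
  funext i
  by_cases hi : i ∈ A
  · rw [splice_of_mem hi, splice_of_mem hi, hxy i hi]
  · rw [splice_of_notMem hi, splice_of_notMem hi]

lemma influence_clamp_le {F : (ι → E) → ℝ} (M : ℝ) (k : ι) :
    influence ν (fun x => clamp M (F x)) k ≤ influence ν F k :=
  eLpNorm_mono fun _ => abs_clamp_sub_clamp_le _ _ _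

variable [IsProbabilityMeasure ν]

lemma measurable_coordAverage {A : Set ι} {F : (ι → E) → ℝ} (hF : Measurable F) :
    Measurable (coordAverage ν A F) := by
  have h : StronglyMeasurable fun p : (ι → E) × (ι → E) => F (splice A p.1 p.2) :=
    (hF.comp (measurable_splice measurable_fst measurable_snd)).stronglyMeasurable
  exact h.integral_prod_right.measurable

lemma abs_coordAverage_le {A : Set ι} {F : (ι → E) → ℝ} {M : ℝ} (hM : ∀ x, |F x| ≤ M)
    (x : ι → E) : |coordAverage ν A F x| ≤ M := by
  have := norm_integral_le_of_norm_le_const (μ := iidLaw ι ν) (f := fun y => F (splice A x y))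
    (.of_forall fun y => hM _)
  simpa [coordAverage] using this

lemma integrable_splice_right {A : Set ι} {F : (ι → E) → ℝ} (hF : Measurable F) {M : ℝ}
    (hM : ∀ x, |F x| ≤ M) (x : ι → E) :
    Integrable (fun y => F (splice A x y)) (iidLaw ι ν) :=
  .of_bound (hF.comp (measurable_splice measurable_const measurable_id)).aestronglyMeasurable M
    (.of_forall fun _ => hM _)

lemma measurePreserving_splice_swap (A : Set ι) :
    MeasurePreserving (fun p : (ι → E) × (ι → E) => splice A p.1 p.2)
      (iidPair ι ν) (iidLaw ι ν) :=
  (measurePreserving_splice ν A).comp Measure.measurePreserving_swap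

/-- `coordAverage ν A F` is at least as close to any function of the coordinates in `A` as `F`
is. -/
lemma eLpNorm_coordAverage_sub_le {A : Set ι} {F F' : (ι → E) → ℝ} (hF : Measurable F) {M : ℝ}
    (hM : ∀ x, |F x| ≤ M) (hF' : Measurable F') (hF'A : DependsOn F' A) :
    eLpNorm (fun x => coordAverage ν A F x - F' x) 2 (iidLaw ι ν) ≤
      eLpNorm (fun x => F x - F' x) 2 (iidLaw ι ν) := by
  have hm : Measurable fun x => F x - F' x := hF.sub hF'
  rw [← eLpNorm_comp_measurePreserving hm.aestronglyMeasurable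
    (measurePreserving_splice_swap (ν := ν) A)]
  refine le_trans (le_of_eq ?_) (eLpNorm_integral_prod_le
    (hm.comp (measurable_splice measurable_fst measurable_snd)))
  refine congrArg (eLpNorm · 2 _) (funext fun x => ?_)
  have e : ∀ z, F' (splice A x z) = F' x := fun z => hF'A fun i hi => splice_of_mem hi
  simp only [Function.comp_apply, e]
  rw [integral_sub (integrable_splice_right hF hM _) (integrable_const _)]
  simp [coordAverage]

lemma integral_coordAverage {A : Set ι} {F : (ι → E) → ℝ} (hF : Integrable F (iidLaw ι ν)) :
    ∫ x, coordAverage ν A F x ∂iidLaw ι ν = ∫ x, F x ∂iidLaw ι ν := by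
  have h := measurePreserving_splice_swap (ν := ν) A
  have hi : Integrable (fun p : (ι → E) × (ι → E) => F (splice A p.1 p.2)) (iidPair ι ν) :=
    h.integrable_comp_of_integrable hF
  rw [← integral_comp_measurePreserving h hF.1]
  exact (integral_prod _ hi).symm

lemma influence_coordAverage_le {A : Set ι} {F : (ι → E) → ℝ} (hF : Measurable F) {M : ℝ}
    (hM : ∀ x, |F x| ≤ M) (k : ι) :
    influence ν (coordAverage ν A F) k ≤ influence ν F k := by
  by_cases hk : k ∈ A
  · have hmp : MeasurePreserving
        (fun q : ((ι → E) × (ι → E)) × (ι → E) => (splice A q.1.1 q.2, q.1.2))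
        ((iidPair ι ν).prod (iidLaw ι ν)) (iidPair ι ν) := by
      have h1 : MeasurePreserving (Prod.swap : ((ι → E) × (ι → E)) × (ι → E) → _)
          ((iidPair ι ν).prod (iidLaw ι ν)) ((iidLaw ι ν).prod (iidPair ι ν)) :=
        Measure.measurePreserving_swap
      have h2 := (measurePreserving_prodAssoc (iidLaw ι ν) (iidLaw ι ν) (iidLaw ι ν)).symm
      have h3 := (measurePreserving_splice (ι := ι) ν A).prod (MeasurePreserving.id (iidLaw ι ν))
      exact h3.comp (h2.comp h1)
    have hm : Measurable fun p : (ι → E) × (ι → E) => F p.1 - F (splice {k} p.2 p.1) :=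
      (hF.comp measurable_fst).sub (hF.comp (measurable_splice measurable_snd measurable_fst))
    rw [influence, influence, ← eLpNorm_comp_measurePreserving hm.aestronglyMeasurable hmp]
    refine le_trans (le_of_eq ?_) (eLpNorm_integral_prod_le (hm.comp hmp.measurable))
    refine congrArg (eLpNorm · 2 _) (funext fun p => ?_)
    have e : ∀ z, splice {k} p.2 (splice A p.1 z) = splice A (splice {k} p.2 p.1) z := by
      intro z
      funext i
      by_cases h1 : i = k
      · subst h1
        rw [splice_of_mem hk, splice_singleton_self, splice_singleton_self]
      · simp only [splice, Set.mem_singleton_iff, h1, if_false]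
    simp only [Function.comp_apply, e]
    exact (integral_sub (integrable_splice_right hF hM _) (integrable_splice_right hF hM _)).symm
  · rw [influence_eq_zero_of_dependsOn (dependsOn_coordAverage A F) hk]
    exact zero_le

/-- A centred square-integrable function is an `L²` limit of centred bounded functions of finitely
many coordinates, none of whose influences exceeds the corresponding influence of the function. -/
lemma exists_bounded_local_approx [Countable ι] {f : (ι → E) → ℝ} (hfm : Measurable f)
    (hf : MemLp f 2 (iidLaw ι ν)) (hf0 : ∫ x, f x ∂iidLaw ι ν = 0) {ρ : ℝ} (hρ : 0 < ρ) :
    ∃ (A : Finset ι) (h : (ι → E) → ℝ) (M : ℝ), Measurable h ∧ DependsOn h A ∧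
      (∀ x, |h x| ≤ M) ∧ ∫ x, h x ∂iidLaw ι ν = 0 ∧
      eLpNorm (fun x => f x - h x) 2 (iidLaw ι ν) ≤ ENNReal.ofReal ρ ∧
      ∀ k, influence ν h k ≤ influence ν f k := by
  obtain ⟨M, hM0, hM⟩ := exists_clamp_approx hfm hf (ρ := ρ / 4) (by positivity)
  set G : (ι → E) → ℝ := fun x => clamp M (f x) with hG
  have hGm : Measurable G := (measurable_clamp M).comp hfm
  have hGb : ∀ x, |G x| ≤ M := fun x => abs_clamp_le hM0 _
  have hG2 : MemLp G 2 (iidLaw ι ν) := .of_bound hGm.aestronglyMeasurable M (.of_forall hGb)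
  obtain ⟨A, F', hF'A, hF'm, hF'2, hF'⟩ :=
    exists_dependsOn_finset_approx ν hGm hG2 (ρ := ρ / 4) (by positivity)
  set Q := coordAverage ν (A : Set ι) G with hQ
  have hQm : Measurable Q := measurable_coordAverage hGm
  have hQb : ∀ x, |Q x| ≤ M := abs_coordAverage_le hGb
  have hQ2 : MemLp Q 2 (iidLaw ι ν) := .of_bound hQm.aestronglyMeasurable M (.of_forall hQb)
  set c := ∫ x, G x ∂iidLaw ι ν with hc
  have hQc : ∫ x, Q x ∂iidLaw ι ν = c := integral_coordAverage (hG2.integrable one_le_two)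
  refine ⟨A, fun x => Q x - c, M + |c|, hQm.sub_const c, fun x y hxy => ?_, fun x => ?_, ?_, ?_,
    fun k => ?_⟩
  · have : Q x = Q y := dependsOn_coordAverage _ _ hxy
    simp only [this]
  · exact (abs_sub _ _).trans (add_le_add (hQb x) le_rfl)
  · rw [integral_sub (hQ2.integrable one_le_two) (integrable_const _), hQc]
    simp
  · have hc' : |c| ≤ ρ / 4 := by
      have h1 : -c = ∫ x, f x - G x ∂iidLaw ι ν := by
        rw [integral_sub (hf.integrable one_le_two) (hG2.integrable one_le_two), hf0, zero_sub]
      have h2 := abs_integral_mul_le (hf.sub hG2) (memLp_const (1 : ℝ))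
      simp only [Pi.sub_apply, mul_one] at h2
      rw [← abs_neg, h1]
      refine h2.trans ?_
      rw [eLpNorm_const _ two_ne_zero (NeZero.ne _)]
      have h3 : (eLpNorm (f - G) 2 (iidLaw ι ν)).toReal ≤ ρ / 4 :=
        ENNReal.toReal_le_of_le_ofReal (by positivity) hM
      simpa using h3
    have hQF' := (eLpNorm_coordAverage_sub_le (ν := ν) hGm hGb hF'm hF'A).trans hF'
    have e : (fun x => f x - (Q x - c)) =
        ((fun x => f x - G x) + fun x => G x - F' x) - ((fun x => Q x - F' x) - fun _ => c) := by
      funext x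
      simp only [Pi.sub_apply, Pi.add_apply]
      ring
    have hcn : eLpNorm (fun _ : ι → E => c) 2 (iidLaw ι ν) ≤ ENNReal.ofReal (ρ / 4) := by
      rw [eLpNorm_const _ two_ne_zero (NeZero.ne _), ← ofReal_norm]
      simpa using ENNReal.ofReal_le_ofReal hc'
    rw [e]
    refine (eLpNorm_sub_le ((hf.sub hG2).add (hG2.sub hF'2)).1
      ((hQ2.sub hF'2).sub (memLp_const c)).1 one_le_two).trans ?_
    refine (add_le_add ((eLpNorm_add_le (hf.sub hG2).1 (hG2.sub hF'2).1 one_le_two).trans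
      (add_le_add hM hF'))
      ((eLpNorm_sub_le (hQ2.sub hF'2).1 aestronglyMeasurable_const one_le_two).trans
      (add_le_add hQF' hcn))).trans (le_of_eq ?_)
    rw [← ENNReal.ofReal_add (by positivity) (by positivity),
      ← ENNReal.ofReal_add (by positivity) (by positivity)]
    congr 1
    ring
  · rw [influence_sub_const]
    exact (influence_coordAverage_le hGm hGb k).trans (influence_clamp_le M k)

/-- The approximation of `exists_bounded_local_approx` can be chosen so that the influences of the
error have an arbitrarily small sum. -/
lemma exists_bounded_local_approx_influence [Countable ι] {f : (ι → E) → ℝ} (hfm : Measurable f)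
    (hf : MemLp f 2 (iidLaw ι ν)) (hf0 : ∫ x, f x ∂iidLaw ι ν = 0)
    (hsum : ∑' k, influence ν f k ≠ ∞) {η : ℝ} (hη : 0 < η) :
    ∃ (A : Finset ι) (h : (ι → E) → ℝ) (M : ℝ), Measurable h ∧ DependsOn h A ∧
      (∀ x, |h x| ≤ M) ∧ ∫ x, h x ∂iidLaw ι ν = 0 ∧
      ∑' k, influence ν (fun x => f x - h x) k ≤ ENNReal.ofReal η := by
  have hη4 : 0 < ENNReal.ofReal (η / 4) := by simpa using hη
  obtain ⟨B, hB⟩ := ((ENNReal.tendsto_tsum_compl_atTop_zero hsum).eventually_lt_const hη4).exists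
  set ρ := η / (4 * (B.card + 1)) with hρ
  have hρ0 : 0 < ρ := by positivity
  obtain ⟨A, h, M, hhm, hhA, hhM, hh0, hhρ, hhk⟩ := exists_bounded_local_approx hfm hf hf0 hρ0
  have hh2 : MemLp h 2 (iidLaw ι ν) := .of_bound hhm.aestronglyMeasurable M (.of_forall hhM)
  refine ⟨A, h, M, hhm, hhA, hhM, hh0, ?_⟩
  rw [← ENNReal.sum_add_tsum_compl B]
  -- On `B` the `L²` error controls the influences; off `B` those of `f` and of `h` are both small.
  have h1 : ∑ k ∈ B, influence ν (fun x => f x - h x) k ≤ ENNReal.ofReal (η / 2) := by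
    refine (Finset.sum_le_card_nsmul B _ (2 * ENNReal.ofReal ρ) fun k _ =>
      (influence_le_two_mul (hf.sub hh2) k).trans (mul_le_mul_right hhρ 2)).trans ?_
    rw [nsmul_eq_mul, ← ENNReal.ofReal_natCast, ← ENNReal.ofReal_ofNat 2,
      ← ENNReal.ofReal_mul (by norm_num), ← ENNReal.ofReal_mul (by positivity)]
    refine ENNReal.ofReal_le_ofReal ?_
    rw [hρ]
    field_simp
    linarith
  have h2 : ∑' k : {k // k ∉ B}, influence ν (fun x => f x - h x) k ≤ ENNReal.ofReal (η / 2) := by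
    refine (ENNReal.tsum_le_tsum (g := fun k : {k // k ∉ B} => 2 * influence ν f k)
      fun k => ?_).trans ?_
    · refine (influence_sub_le hf hh2 _).trans ?_
      rw [two_mul]
      exact add_le_add le_rfl (hhk _)
    · rw [ENNReal.tsum_mul_left]
      refine (mul_le_mul_right hB.le 2).trans (le_of_eq ?_)
      rw [← ENNReal.ofReal_ofNat 2, ← ENNReal.ofReal_mul (by norm_num)]
      congr 1
      ring
  refine (add_le_add h1 h2).trans (le_of_eq ?_)
  rw [← ENNReal.ofReal_add (by positivity) (by positivity)]
  simp

end LocalApproximation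

/-! ### Variance of sums indexed by a group -/

section SumVariance

variable {ι E : Type*} [AddCommGroup ι] [Countable ι] [MeasurableSpace E] {ν : Measure E}
  [IsProbabilityMeasure ν]

/-- If the influences of the summands are dominated by a convolution kernel `b`, then the variance
of a sum over `Γ` is at most `|Γ|` times the square of the total mass of `b`, whatever the shape
of `Γ`. -/
lemma variance_sum_le {f : ι → (ι → E) → ℝ} {b : ι → ℝ≥0∞} (hfm : ∀ i, Measurable (f i))
    (hf : ∀ i, MemLp (f i) 2 (iidLaw ι ν)) (hb : ∀ i k, influence ν (f i) k ≤ b (k - i))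
    (Γ : Finset ι) :
    ENNReal.ofReal (Var[fun x => ∑ i ∈ Γ, f i x; iidLaw ι ν]) ≤ Γ.card * (∑' k, b k) ^ 2 := by
  refine (variance_le_tsum_influence_sq (Finset.measurable_sum _ fun i _ => hfm i)
    (memLp_finsetSum _ fun i _ => hf i)).trans ?_
  have hcol : ∀ k, ∑ i ∈ Γ, b (k - i) ≤ ∑' k, b k := fun k => by
    refine (ENNReal.sum_le_tsum Γ).trans (le_of_eq ?_)
    exact (Equiv.subLeft k).tsum_eq b
  have hrow : ∀ i, ∑' k, b (k - i) = ∑' k, b k := fun i => (Equiv.subRight i).tsum_eq b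
  calc ∑' k, influence ν (fun x => ∑ i ∈ Γ, f i x) k ^ 2
      ≤ ∑' k, (∑' k, b k) * ∑ i ∈ Γ, b (k - i) := by
        refine ENNReal.tsum_le_tsum fun k => ?_
        have h := (influence_sum_le (fun i _ => hf i) k).trans
          (Finset.sum_le_sum fun i _ => hb i k : _ ≤ ∑ i ∈ Γ, b (k - i))
        rw [sq]
        exact mul_le_mul' (h.trans (hcol k)) h
    _ = Γ.card * (∑' k, b k) ^ 2 := by
        rw [ENNReal.tsum_mul_left, Summable.tsum_finsetSum fun i _ => ENNReal.summable]
        simp only [hrow, Finset.sum_const, nsmul_eq_mul]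
        ring

end SumVariance

/-! ### Translations -/

section Translation

variable {ι E : Type*} [AddCommGroup ι]

/-- The configuration `x` seen from the site `i`. -/
def translate (i : ι) (x : ι → E) : ι → E := fun j => x (i + j)

lemma translate_zero (x : ι → E) : translate 0 x = x :=
  funext fun j => congrArg x (zero_add j)

lemma dependsOn_comp_translate {β : Type*} {h : (ι → E) → β} {A : Set ι} (hA : DependsOn h A)
    (i : ι) : DependsOn (h ∘ translate i) {k | k - i ∈ A} := by
  intro x y hxy
  refine hA fun j hj => hxy (i + j) ?_
  simpa using hj

variable [MeasurableSpace E]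

@[fun_prop]
lemma measurable_translate (i : ι) : Measurable (translate (E := E) i) :=
  measurable_pi_iff.2 fun _ => measurable_pi_apply _

variable {ν : Measure E} [IsProbabilityMeasure ν]

lemma measurePreserving_translate (i : ι) :
    MeasurePreserving (translate i) (iidLaw ι ν) (iidLaw ι ν) := by
  refine ⟨measurable_translate i, ?_⟩
  have h := Measure.infinitePi_map_piCongrLeft (fun _ : ι => ν) (Equiv.addLeft i).symm
  have e : (MeasurableEquiv.piCongrLeft (fun _ : ι => E) (Equiv.addLeft i).symm :
      (ι → E) → (ι → E)) = translate i := by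
    funext x j
    have := Equiv.piCongrLeft_apply_apply (P := fun _ : ι => E) (Equiv.addLeft i).symm x (i + j)
    rw [show (Equiv.addLeft i).symm (i + j) = j by simp] at this
    exact this
  rwa [e] at h

lemma influence_comp_translate {h : (ι → E) → ℝ} (hm : Measurable h) (i k : ι) :
    influence ν (h ∘ translate i) k = influence ν h (k - i) := by
  have hmp := (measurePreserving_translate (ν := ν) i).prod (measurePreserving_translate (ν := ν) i)
  have hM : Measurable fun p : (ι → E) × (ι → E) => h p.1 - h (splice {k - i} p.2 p.1) :=
    (hm.comp measurable_fst).sub (hm.comp (measurable_splice measurable_snd measurable_fst))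
  rw [influence, influence, ← eLpNorm_comp_measurePreserving hM.aestronglyMeasurable hmp]
  refine congrArg (eLpNorm · 2 _) (funext fun p => ?_)
  simp only [Function.comp_apply, Prod.map]
  congr 2
  funext j
  by_cases hj : i + j = k
  · obtain rfl : j = k - i := by rw [← hj]; abel
    rw [splice_singleton_self]
    simp only [translate, add_sub_cancel, splice_singleton_self]
  · rw [splice_singleton_of_ne (by rintro rfl; exact hj (by abel))]
    simp only [translate]
    rw [splice_singleton_of_ne hj]

end Translation

/-! ### The differential equation of a Gaussian characteristic function -/

section SteinODE

/-- If `χ` solves the differential equation `χ' = -V s χ` of the Gaussian characteristic function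
up to an error `C`, then it is within `C |s|` of its solution. -/
lemma norm_sub_exp_le_of_deriv {χ χ' : ℝ → ℂ} {V C s : ℝ} (hV : 0 ≤ V)
    (hd : ∀ r, HasDerivAt χ (χ' r) r) (h0 : χ 0 = 1)
    (hC : ∀ r, |r| ≤ |s| → ‖χ' r + (r * V : ℝ) * χ r‖ ≤ C) :
    ‖χ s - (Real.exp (-(V * s ^ 2 / 2)) : ℝ)‖ ≤ C * |s| := by
  set ψ : ℝ → ℂ := fun r => χ r * (Real.exp (V * r ^ 2 / 2) : ℝ) with hψ
  have hψd : ∀ r, HasDerivAt ψ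
      ((χ' r + (r * V : ℝ) * χ r) * (Real.exp (V * r ^ 2 / 2) : ℝ)) r := by
    intro r
    have h1 : HasDerivAt (fun r : ℝ => Real.exp (V * r ^ 2 / 2))
        (Real.exp (V * r ^ 2 / 2) * (V * r)) r := by
      have h2 : HasDerivAt (fun r : ℝ => V * r ^ 2 / 2) (V * r) r := by
        have := ((hasDerivAt_pow 2 r).const_mul V).div_const 2
        refine this.congr_deriv ?_
        norm_num
        ring
      exact h2.exp
    refine ((hd r).mul h1.ofReal_comp).congr_deriv ?_
    push_cast
    ring
  have hb : ∀ r ∈ Metric.closedBall (0 : ℝ) |s|,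
      ‖(χ' r + (r * V : ℝ) * χ r) * (Real.exp (V * r ^ 2 / 2) : ℝ)‖ ≤
        C * Real.exp (V * s ^ 2 / 2) := by
    intro r hr
    have hr' : |r| ≤ |s| := by simpa using hr
    rw [norm_mul, Complex.norm_real, Real.norm_eq_abs, abs_of_pos (Real.exp_pos _)]
    have hsq : r ^ 2 ≤ s ^ 2 := sq_le_sq.2 hr'
    have := hC r hr'
    have hC0 : 0 ≤ C := (norm_nonneg _).trans this
    gcongr
  have hmv := (convex_closedBall (0 : ℝ) |s|).norm_image_sub_le_of_norm_hasDerivWithin_le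
    (f := ψ) (fun r _ => (hψd r).hasDerivWithinAt) hb (x := 0) (y := s) (by simp) (by simp)
  have e : χ s - (Real.exp (-(V * s ^ 2 / 2)) : ℝ) =
      (ψ s - ψ 0) * (Real.exp (-(V * s ^ 2 / 2)) : ℝ) := by
    have : (Real.exp (V * s ^ 2 / 2) : ℂ) * (Real.exp (-(V * s ^ 2 / 2)) : ℝ) = 1 := by
      rw [← Complex.ofReal_mul, ← Real.exp_add]; simp
    simp only [hψ, h0]
    rw [sub_mul, mul_assoc, this]
    simp
  rw [e, norm_mul, Complex.norm_real, Real.norm_eq_abs, abs_of_pos (Real.exp_pos _)]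
  calc _ ≤ C * Real.exp (V * s ^ 2 / 2) * ‖s - 0‖ * Real.exp (-(V * s ^ 2 / 2)) := by gcongr
    _ = C * |s| * (Real.exp (V * s ^ 2 / 2) * Real.exp (-(V * s ^ 2 / 2))) := by
        rw [sub_zero, Real.norm_eq_abs]; ring
    _ = C * |s| := by rw [← Real.exp_add]; simp

lemma norm_one_sub_exp_neg_sub_le (u : ℝ) :
    ‖1 - Complex.exp (((-u : ℝ) : ℂ) * Complex.I) - u * Complex.I‖ ≤ 2 * u ^ 2 := by
  have e : 1 - Complex.exp (((-u : ℝ) : ℂ) * Complex.I) - u * Complex.I =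
      -(Complex.exp (((-u : ℝ) : ℂ) * Complex.I) - 1 - ((-u : ℝ) : ℂ) * Complex.I) := by
    push_cast; ring
  rw [e, norm_neg]
  have hn : ‖((-u : ℝ) : ℂ) * Complex.I‖ = |u| := by
    rw [norm_mul, Complex.norm_I, mul_one, Complex.norm_real, Real.norm_eq_abs, abs_neg]
  by_cases hu : |u| ≤ 1
  · refine (Complex.norm_exp_sub_one_sub_id_le (hn.trans_le hu)).trans ?_
    rw [hn, sq_abs]
    nlinarith [sq_nonneg u]
  · push Not at hu
    have h1 : ‖Complex.exp (((-u : ℝ) : ℂ) * Complex.I) - 1‖ ≤ |u| := by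
      have := Real.norm_exp_I_mul_ofReal_sub_one_le (x := -u)
      rwa [mul_comm, Real.norm_eq_abs, abs_neg] at this
    refine (norm_sub_le _ _).trans ?_
    rw [hn]
    nlinarith [sq_abs u]

lemma hasDerivAt_integral_exp {α : Type*} [MeasurableSpace α] {m : Measure α}
    [IsProbabilityMeasure m] {S : α → ℝ} (hS : Measurable S) {c : ℝ} (hc : ∀ x, |S x| ≤ c)
    (s : ℝ) :
    HasDerivAt (fun s : ℝ => ∫ x, Complex.exp (((s * S x : ℝ) : ℂ) * Complex.I) ∂m)
      (∫ x, Complex.exp (((s * S x : ℝ) : ℂ) * Complex.I) * (S x * Complex.I) ∂m) s := by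
  have hm : ∀ s : ℝ, Measurable fun x => Complex.exp (((s * S x : ℝ) : ℂ) * Complex.I) := by
    intro s; fun_prop
  refine (hasDerivAt_integral_of_dominated_loc_of_deriv_le (bound := fun _ => c)
    (F := fun (s : ℝ) x => Complex.exp (((s * S x : ℝ) : ℂ) * Complex.I))
    (F' := fun (s : ℝ) x => Complex.exp (((s * S x : ℝ) : ℂ) * Complex.I) * (S x * Complex.I))
    (s := Set.univ) Filter.univ_mem (.of_forall fun s => (hm s).aestronglyMeasurable) ?_ ?_ ?_
    (integrable_const _) ?_).2
  · exact .of_bound (hm s).aestronglyMeasurable 1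
      (.of_forall fun x => (Complex.norm_exp_ofReal_mul_I _).le)
  · exact ((hm s).mul (by fun_prop)).aestronglyMeasurable
  · refine .of_forall fun x r _ => ?_
    rw [norm_mul, Complex.norm_exp_ofReal_mul_I, norm_mul, Complex.norm_I, Complex.norm_real]
    simpa using hc x
  · refine .of_forall fun x r _ => ?_
    have h1 : HasDerivAt (fun r : ℝ => r * S x) (S x) r := by
      simpa using (hasDerivAt_id r).mul_const (S x)
    exact (h1.ofReal_comp.mul_const Complex.I).cexp

end SteinODE

/-! ### Bounded fields with finite range of dependence -/

section LocalField

open scoped Pointwise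

variable {ι E : Type*} [AddCommGroup ι]

/-- The sum over the sites of `Γ` of the stationary field `i ↦ h (translate i x)`. -/
def siteSum (h : (ι → E) → ℝ) (Γ : Finset ι) (x : ι → E) : ℝ := ∑ i ∈ Γ, h (translate i x)

variable {h : (ι → E) → ℝ} {A D Γ : Finset ι} {M : ℝ}

lemma siteSum_sub (f h : (ι → E) → ℝ) (Γ : Finset ι) (x : ι → E) :
    siteSum (fun x => f x - h x) Γ x = siteSum f Γ x - siteSum h Γ x := by
  simp [siteSum]

lemma abs_siteSum_le (hM : ∀ x, |h x| ≤ M) (x : ι → E) : |siteSum h Γ x| ≤ Γ.card * M := by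
  refine (Finset.abs_sum_le_sum_abs _ _).trans ?_
  simpa using Finset.sum_le_card_nsmul Γ (fun i => |h (translate i x)|) M fun i _ => hM _

lemma dependsOn_siteSum (hA : DependsOn h A) :
    DependsOn (siteSum h Γ) {k | ∃ j ∈ Γ, k - j ∈ A} := by
  intro x y hxy
  refine Finset.sum_congr rfl fun j hj => ?_
  exact dependsOn_comp_translate hA j fun k hk => hxy k ⟨j, hj, hk⟩

lemma measurable_siteSum [MeasurableSpace E] (hm : Measurable h) : Measurable (siteSum h Γ) :=
  Finset.measurable_sum _ fun i _ => hm.comp (measurable_translate i)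

variable [DecidableEq ι]

/-- The part of `siteSum h Γ` carried by the sites `j` with `j - i ∈ D`. -/
noncomputable def nearSum (h : (ι → E) → ℝ) (D Γ : Finset ι) (i : ι) : (ι → E) → ℝ :=
  siteSum h (Γ.filter fun j => j - i ∈ D)

/-- The part of `siteSum h Γ` carried by the sites `j` with `j - i ∉ D`. -/
noncomputable def farSum (h : (ι → E) → ℝ) (D Γ : Finset ι) (i : ι) : (ι → E) → ℝ :=
  siteSum h (Γ.filter fun j => j - i ∉ D)

lemma nearSum_add_farSum (i : ι) (x : ι → E) :
    nearSum h D Γ i x + farSum h D Γ i x = siteSum h Γ x := by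
  exact Finset.sum_filter_add_sum_filter_not Γ (fun j => j - i ∈ D) _

lemma abs_nearSum_le (hM : ∀ x, |h x| ≤ M) (i : ι) (x : ι → E) :
    |nearSum h D Γ i x| ≤ D.card * M := by
  refine (abs_siteSum_le hM x).trans ?_
  have hM0 : 0 ≤ M := (abs_nonneg _).trans (hM x)
  refine mul_le_mul_of_nonneg_right (Nat.cast_le.2 ?_) hM0
  exact Finset.card_le_card_of_injOn (t := D) (fun j => j - i) 
    (fun j hj => (Finset.mem_filter.1 hj).2) fun j _ k _ hjk => by simpa using hjk

lemma dependsOn_farSum (hA : DependsOn h A) (i : ι) :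
    DependsOn (farSum h (A - A) Γ i) {k | k - i ∈ A}ᶜ := by
  refine (dependsOn_siteSum hA).mono ?_
  rintro k ⟨j, hj, hkj⟩ hki
  refine (Finset.mem_filter.1 hj).2 ?_
  rw [show j - i = (k - i) - (k - j) by abel]
  exact Finset.sub_mem_sub hki hkj

lemma dependsOn_mul_nearSum (hA : DependsOn h A) (i : ι) :
    DependsOn (fun x => h (translate i x) * nearSum h D Γ i x)
      {k | k - i ∈ A ∪ (D + A)} := by
  intro x y hxy
  have h1 : h (translate i x) = h (translate i y) :=
    dependsOn_comp_translate hA i fun k (hk : k - i ∈ A) => hxy k (Finset.mem_union_left _ hk)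
  have h2 : nearSum h D Γ i x = nearSum h D Γ i y := by
    refine dependsOn_siteSum hA fun k ⟨j, hj, hkj⟩ => hxy k (Finset.mem_union_right _ ?_)
    rw [show k - i = (j - i) + (k - j) by abel]
    exact Finset.add_mem_add (Finset.mem_filter.1 hj).2 hkj
  simp only [h1, h2]

variable [MeasurableSpace E]

lemma measurable_nearSum (hm : Measurable h) (i : ι) : Measurable (nearSum h D Γ i) :=
  measurable_siteSum hm

lemma measurable_farSum (hm : Measurable h) (i : ι) : Measurable (farSum h D Γ i) :=
  measurable_siteSum hm

variable {ν : Measure E} [IsProbabilityMeasure ν]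

/-- Each summand is centred and independent of the sum over the sites whose ranges of dependence do
not meet its own. -/
lemma integral_mul_comp_farSum_eq_zero {L : Type*} [RCLike L] (hm : Measurable h)
    (hA : DependsOn h A) (h0 : ∫ x, h x ∂iidLaw ι ν = 0) (i : ι) {φ : ℝ → L}
    (hφ : Measurable φ) :
    ∫ x, (h (translate i x) : L) * φ (farSum h (A - A) Γ i x) ∂iidLaw ι ν = 0 := by
  have e := integral_mul_of_dependsOn ν (A := {k | k - i ∈ A})
    (F := fun x => (h (translate i x) : L)) (G := fun x => φ (farSum h (A - A) Γ i x))
    (RCLike.measurable_ofReal.comp (hm.comp (measurable_translate i)))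
    (hφ.comp (measurable_farSum hm i))
    (fun x y hxy => by
      have : h (translate i x) = h (translate i y) := dependsOn_comp_translate hA i hxy
      simp only [this])
    (fun x y hxy => by
      have : farSum h (A - A) Γ i x = farSum h (A - A) Γ i y := dependsOn_farSum hA i hxy
      simp only [this])
  rw [e, integral_ofReal, integral_comp_measurePreserving (measurePreserving_translate i)
    hm.aestronglyMeasurable, h0]
  simp

/-- For a centred field with finite range of dependence, `nearSum` carries all of the variance. -/
lemma integral_siteSum_sq (hm : Measurable h) (hA : DependsOn h A) (hM : ∀ x, |h x| ≤ M)
    (h0 : ∫ x, h x ∂iidLaw ι ν = 0) :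
    ∫ x, siteSum h Γ x ^ 2 ∂iidLaw ι ν =
      ∫ x, ∑ i ∈ Γ, h (translate i x) * nearSum h (A - A) Γ i x ∂iidLaw ι ν := by
  have hM0 : 0 ≤ M := by
    obtain ⟨x⟩ := (iidLaw ι ν).nonempty_of_neZero
    exact (abs_nonneg _).trans (hM x)
  have hint : ∀ (i : ι) (B : Finset ι),
      Integrable (fun x => h (translate i x) * siteSum h B x) (iidLaw ι ν) := by
    intro i B
    refine .of_bound ((hm.comp (measurable_translate i)).mul
      (measurable_siteSum hm)).aestronglyMeasurable (M * (B.card * M)) (.of_forall fun x => ?_)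
    rw [norm_mul]
    exact mul_le_mul (hM _) (abs_siteSum_le hM x) (norm_nonneg _) hM0
  have e1 : ∀ x, siteSum h Γ x ^ 2 = ∑ i ∈ Γ, h (translate i x) * siteSum h Γ x := by
    intro x
    rw [← Finset.sum_mul, sq]
    rfl
  simp_rw [e1]
  rw [integral_finsetSum _ fun i _ => hint i Γ]
  unfold nearSum
  rw [integral_finsetSum _ fun i _ => hint i _]
  refine Finset.sum_congr rfl fun i _ => ?_
  have hfar : ∫ x, h (translate i x) * farSum h (A - A) Γ i x ∂iidLaw ι ν = 0 :=
    integral_mul_comp_farSum_eq_zero (L := ℝ) hm hA h0 i measurable_id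
  have i1 : Integrable (fun x => h (translate i x) * nearSum h (A - A) Γ i x) (iidLaw ι ν) :=
    hint i _
  have i2 : Integrable (fun x => h (translate i x) * farSum h (A - A) Γ i x) (iidLaw ι ν) :=
    hint i _
  simp_rw [← nearSum_add_farSum (h := h) (D := A - A) (Γ := Γ) i, mul_add]
  rw [integral_add i1 i2, hfar, add_zero]
  rfl

/-- The quadratic form of the near interactions has variance of order `|Γ|`. -/
lemma exists_variance_sum_mul_nearSum_le [Countable ι] (hm : Measurable h) (hA : DependsOn h A)
    (hM : ∀ x, |h x| ≤ M) (D : Finset ι) :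
    ∃ K : ℝ, 0 ≤ K ∧ ∀ Γ : Finset ι,
      Var[fun x => ∑ i ∈ Γ, h (translate i x) * nearSum h D Γ i x; iidLaw ι ν]
        ≤ Γ.card * K ^ 2 := by
  classical
  have hM0 : 0 ≤ M := by
    obtain ⟨x⟩ := (iidLaw ι ν).nonempty_of_neZero
    exact (abs_nonneg _).trans (hM x)
  set B := A ∪ (D + A) with hB
  set c := M * (D.card * M) with hc
  have hc0 : 0 ≤ c := by positivity
  refine ⟨B.card * (2 * c), by positivity, fun Γ => ?_⟩
  have hmi : ∀ i, Measurable fun x => h (translate i x) * nearSum h D Γ i x := fun i =>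
    (hm.comp (measurable_translate i)).mul (measurable_nearSum hm i)
  have hbi : ∀ i x, |h (translate i x) * nearSum h D Γ i x| ≤ c := fun i x => by
    rw [abs_mul]
    exact mul_le_mul (hM _) (abs_nearSum_le hM i x) (abs_nonneg _) hM0
  have key := variance_sum_le (ν := ν) (b := fun k => if k ∈ B then 2 * ENNReal.ofReal c else 0)
    hmi (fun i => .of_bound (hmi i).aestronglyMeasurable c (.of_forall (hbi i)))
    (fun i k => ?_) Γ
  · have e : ∑' k, (if k ∈ B then 2 * ENNReal.ofReal c else 0) =
        ENNReal.ofReal (B.card * (2 * c)) := by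
      clear_value c
      rw [tsum_eq_sum (s := B) fun k hk => by simp [hk], Finset.sum_ite_mem, Finset.inter_self,
        Finset.sum_const, nsmul_eq_mul, ENNReal.ofReal_mul (by positivity),
        ENNReal.ofReal_mul (by positivity), ENNReal.ofReal_natCast, ENNReal.ofReal_ofNat]
    rw [e, ← ENNReal.ofReal_pow (by positivity), ← ENNReal.ofReal_natCast,
      ← ENNReal.ofReal_mul (by positivity)] at key
    exact (ENNReal.ofReal_le_ofReal_iff (by positivity)).1 key
  · split_ifs with hk
    · exact influence_le_of_abs_le (hmi i) (hbi i) k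
    · exact (influence_eq_zero_of_dependsOn (dependsOn_mul_nearSum hA i) hk).le

end LocalField

/-! ### Stein's method for fields with finite range of dependence -/

section LocalFieldCharFun

open scoped Pointwise

variable {ι E : Type*} [AddCommGroup ι] [MeasurableSpace E] {ν : Measure E}
  [IsProbabilityMeasure ν] {h : (ι → E) → ℝ} {A : Finset ι} {M : ℝ}

/-- Quantitative central limit theorem for a centred bounded field with finite range of dependence:
the characteristic function `χ` of the sum over `Γ` nearly solves `χ' (s) = -V s χ (s)`. -/
lemma exists_norm_charFun_siteSum_sub_le [Countable ι] (hm : Measurable h) (hA : DependsOn h A)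
    (hM : ∀ x, |h x| ≤ M) (h0 : ∫ x, h x ∂iidLaw ι ν = 0) :
    ∃ C : ℝ, ∀ (Γ : Finset ι) (s : ℝ),
      ‖∫ x, Complex.exp (((s * siteSum h Γ x : ℝ) : ℂ) * Complex.I) ∂iidLaw ι ν -
        (Real.exp (-((∫ x, siteSum h Γ x ^ 2 ∂iidLaw ι ν) * s ^ 2 / 2)) : ℝ)‖
      ≤ C * (Γ.card * |s| ^ 3 + √Γ.card * s ^ 2) := by
  classical
  have hM0 : 0 ≤ M := by
    obtain ⟨x⟩ := (iidLaw ι ν).nonempty_of_neZero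
    exact (abs_nonneg _).trans (hM x)
  obtain ⟨K, hK0, hK⟩ := exists_variance_sum_mul_nearSum_le (ν := ν) hm hA hM (A - A)
  set d : ℝ := ((A - A).card : ℝ) with hd
  set C₁ := M * (2 * (d * M) ^ 2) with hC₁
  have hC₁0 : 0 ≤ C₁ := by positivity
  refine ⟨C₁ + K, fun Γ s => ?_⟩
  set π := iidLaw ι ν with hπ
  set S := siteSum h Γ with hS
  set W : (ι → E) → ℝ := fun x => ∑ i ∈ Γ, h (translate i x) * nearSum h (A - A) Γ i x with hW
  set V := ∫ x, S x ^ 2 ∂π with hV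
  have hVW : V = ∫ x, W x ∂π := integral_siteSum_sq hm hA hM h0
  have hV0 : 0 ≤ V := integral_nonneg fun x => sq_nonneg _
  have hSm : Measurable S := measurable_siteSum hm
  have hWm : Measurable W := Finset.measurable_sum _ fun i _ =>
    (hm.comp (measurable_translate i)).mul (measurable_nearSum hm i)
  have hSb : ∀ x, |S x| ≤ Γ.card * M := abs_siteSum_le hM
  have hWb : ∀ x, |W x| ≤ Γ.card * (M * (d * M)) := fun x => by
    refine (Finset.abs_sum_le_sum_abs _ _).trans ?_
    refine (Finset.sum_le_card_nsmul Γ _ (M * (d * M)) fun i _ => ?_).trans (by simp)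
    rw [abs_mul]
    exact mul_le_mul (hM _) (abs_nearSum_le hM i x) (abs_nonneg _) hM0
  have hW2 : MemLp W 2 π := .of_bound hWm.aestronglyMeasurable _ (.of_forall hWb)
  set e : ℝ → (ι → E) → ℂ := fun s x => Complex.exp (((s * S x : ℝ) : ℂ) * Complex.I) with he
  have hem : ∀ s, Measurable (e s) := fun s => by
    simp only [he]; fun_prop
  have hen : ∀ s x, ‖e s x‖ = 1 := fun s x => Complex.norm_exp_ofReal_mul_I _
  have hei : ∀ s, Integrable (e s) π := fun s =>
    .of_bound (hem s).aestronglyMeasurable 1 (.of_forall fun x => (hen s x).le)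
  have hmul : ∀ (s : ℝ) {F : (ι → E) → ℝ} {c : ℝ}, Measurable F → (∀ x, |F x| ≤ c) →
      Integrable (fun x => e s x * F x) π := by
    intro s F c hF hc
    refine .of_bound ((hem s).mul (by fun_prop)).aestronglyMeasurable c (.of_forall fun x => ?_)
    rw [norm_mul, hen, one_mul, Complex.norm_real]
    exact hc x
  -- Replacing `W` by its mean `V` costs at most the standard deviation of `W`.
  have hWerr : ∀ s, ‖∫ x, e s x * W x ∂π - V * ∫ x, e s x ∂π‖ ≤ √Γ.card * K := by
    intro s
    have e1 : ∫ x, e s x * W x ∂π - V * ∫ x, e s x ∂π =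
        ∫ x, e s x * ((W x - V : ℝ) : ℂ) ∂π := by
      rw [← integral_const_mul, ← integral_sub (hmul s hWm hWb) ((hei s).const_mul _)]
      refine integral_congr_ae (.of_forall fun x => ?_)
      push_cast; ring
    have e2 : ∫ x, |W x - V| ∂π ≤ √Γ.card * K := by
      refine abs_le_of_sq_le_sq' ?_ (by positivity) |>.2
      have h1 : MemLp (fun x => |W x - V|) 2 π := (hW2.sub (memLp_const V)).abs
      have h2 := variance_nonneg (fun x => |W x - V|) π
      rw [variance_eq_sub h1] at h2
      have h3 : ∫ x, ((fun x => |W x - V|) ^ 2) x ∂π = Var[W; π] := by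
        rw [variance_eq_integral hWm.aemeasurable, ← hVW]
        simp
      rw [h3] at h2
      have h4 := hK Γ
      rw [mul_pow, Real.sq_sqrt (by positivity)]
      linarith
    rw [e1]
    refine (norm_integral_le_integral_norm _).trans (le_trans (le_of_eq ?_) e2)
    refine integral_congr_ae (.of_forall fun x => ?_)
    simp only [norm_mul, hen, one_mul, Complex.norm_real, Real.norm_eq_abs]
  -- Stein's identity: as `h (translate i x)` is centred and independent of the far sum, only the
  -- increment of `e` due to the near sum contributes, and it is linearized.
  have hSerr : ∀ s, ‖∫ x, e s x * S x ∂π - (s * Complex.I) * ∫ x, e s x * W x ∂π‖ ≤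
      Γ.card * C₁ * s ^ 2 := by
    intro s
    set f : ι → (ι → E) → ℂ := fun i x =>
      (h (translate i x) : ℂ) * Complex.exp (((s * farSum h (A - A) Γ i x : ℝ) : ℂ) * Complex.I)
      with hf
    have hf0 : ∀ i, ∫ x, f i x ∂π = 0 := fun i =>
      integral_mul_comp_farSum_eq_zero (L := ℂ) hm hA h0 i
        (φ := fun u => Complex.exp (((s * u : ℝ) : ℂ) * Complex.I)) (by fun_prop)
    have hfi : ∀ i, Integrable (f i) π := fun i => by
      have hfar := measurable_farSum (D := A - A) (Γ := Γ) hm i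
      have hti := hm.comp (measurable_translate (E := E) i)
      refine .of_bound (Measurable.aestronglyMeasurable ?_) M (.of_forall fun x => ?_)
      · exact (Complex.measurable_ofReal.comp hti).mul (by fun_prop)
      · simp only [hf]
        rw [norm_mul, Complex.norm_exp_ofReal_mul_I, mul_one, Complex.norm_real]
        exact hM _
    have e1 : ∫ x, e s x * S x ∂π - (s * Complex.I) * ∫ x, e s x * W x ∂π =
        ∫ x, (e s x * S x - (s * Complex.I) * (e s x * W x)) - ∑ i ∈ Γ, f i x ∂π := by
      have i1 := hmul s hSm hSb
      have i2 := (hmul s hWm hWb).const_mul (s * Complex.I)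
      have i3 : Integrable (fun x => e s x * S x - (s * Complex.I) * (e s x * W x)) π := i1.sub i2
      rw [integral_sub i3 (integrable_finsetSum _ fun i _ => hfi i),
        integral_sub i1 i2, integral_const_mul, integral_finsetSum _ fun i _ => hfi i]
      simp [hf0]
    rw [e1]
    refine (norm_integral_le_of_norm_le_const (C := Γ.card * C₁ * s ^ 2)
      (.of_forall fun x => ?_)).trans (by simp)
    have e2 : (e s x * S x - (s * Complex.I) * (e s x * W x)) - ∑ i ∈ Γ, f i x =
        ∑ i ∈ Γ, (h (translate i x) : ℂ) * (e s x *
          (1 - Complex.exp (((-(s * nearSum h (A - A) Γ i x) : ℝ) : ℂ) * Complex.I) -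
            ((s * nearSum h (A - A) Γ i x : ℝ) : ℂ) * Complex.I)) := by
      have e3 : ∀ i, f i x = (h (translate i x) : ℂ) * (e s x *
          Complex.exp (((-(s * nearSum h (A - A) Γ i x) : ℝ) : ℂ) * Complex.I)) := by
        intro i
        simp only [hf, he]
        rw [← Complex.exp_add, hS, ← nearSum_add_farSum (h := h) (D := A - A) (Γ := Γ) i]
        congr 2
        push_cast; ring
      have e4 : (S x : ℂ) = ∑ i ∈ Γ, (h (translate i x) : ℂ) := by
        simp [hS, siteSum]
      have e5 : (W x : ℂ) =
          ∑ i ∈ Γ, (h (translate i x) : ℂ) * (nearSum h (A - A) Γ i x : ℂ) := by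
        simp [hW]
      rw [e4, e5, Finset.mul_sum, Finset.mul_sum, Finset.mul_sum, ← Finset.sum_sub_distrib,
        ← Finset.sum_sub_distrib]
      refine Finset.sum_congr rfl fun i _ => ?_
      rw [e3]
      push_cast
      ring
    rw [e2]
    refine (norm_sum_le _ _).trans ((Finset.sum_le_card_nsmul Γ _ (C₁ * s ^ 2)
      fun i _ => ?_).trans (by simp [mul_assoc]))
    rw [norm_mul, norm_mul, hen, one_mul, Complex.norm_real, hC₁, mul_assoc]
    refine mul_le_mul (hM _) ((norm_one_sub_exp_neg_sub_le _).trans ?_) (norm_nonneg _) hM0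
    have h1 : nearSum h (A - A) Γ i x ^ 2 ≤ (d * M) ^ 2 :=
      sq_le_sq' (abs_le.1 (abs_nearSum_le hM i x)).1 (abs_le.1 (abs_nearSum_le hM i x)).2
    rw [mul_pow]
    nlinarith [sq_nonneg s]
  have hfinal := norm_sub_exp_le_of_deriv (χ := fun s => ∫ x, e s x ∂π) (V := V) (s := s)
    (C := Γ.card * C₁ * s ^ 2 + |s| * (√Γ.card * K)) hV0
    (fun r => hasDerivAt_integral_exp hSm hSb r) (by simp [he]) (fun r hr => ?_)
  · refine hfinal.trans ?_
    have h3 : |s| ^ 3 = s ^ 2 * |s| := by rw [pow_succ, sq_abs]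
    have h4 : s ^ 2 = |s| * |s| := by rw [← sq, sq_abs]
    have p1 : 0 ≤ (Γ.card : ℝ) * |s| ^ 3 := by positivity
    have p2 : 0 ≤ √(Γ.card : ℝ) * s ^ 2 := by positivity
    calc _ = C₁ * (Γ.card * |s| ^ 3) + K * (√Γ.card * s ^ 2) := by
          rw [h3]; nth_rewrite 3 [h4]; ring
      _ ≤ _ := by nlinarith [mul_nonneg hC₁0 p2, mul_nonneg hK0 p1]
  · have e1 : ∫ x, e r x * (S x * Complex.I) ∂π + ((r * V : ℝ) : ℂ) * ∫ x, e r x ∂π =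
        Complex.I * (∫ x, e r x * S x ∂π - (r * Complex.I) * ∫ x, e r x * W x ∂π) -
        r * (∫ x, e r x * W x ∂π - V * ∫ x, e r x ∂π) := by
      simp_rw [← mul_assoc]
      rw [integral_mul_const]
      push_cast
      linear_combination ((r : ℂ) * ∫ x, e r x * W x ∂π) * Complex.I_mul_I
    rw [e1]
    refine (norm_sub_le _ _).trans (add_le_add ?_ ?_)
    · rw [norm_mul, Complex.norm_I, one_mul]
      refine (hSerr r).trans ?_
      have := sq_le_sq.2 hr
      gcongr
    · rw [norm_mul, Complex.norm_real, Real.norm_eq_abs]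
      exact mul_le_mul hr (hWerr r) (norm_nonneg _) (abs_nonneg _)

end LocalFieldCharFun

/-! ### Fields with summable influences -/

section SummableInfluence

lemma toReal_eLpNorm_two_sq {α : Type*} [MeasurableSpace α] {m : Measure α} {f : α → ℝ}
    (hf : MemLp f 2 m) : (eLpNorm f 2 m).toReal ^ 2 = ∫ x, f x ^ 2 ∂m := by
  rw [← ENNReal.toReal_pow, eLpNorm_two_sq, integral_eq_lintegral_of_nonneg_ae
    (.of_forall fun x => sq_nonneg _) hf.integrable_sq.1]
  congr 1
  refine lintegral_congr fun x => ?_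
  rw [← ofReal_norm, ← ENNReal.ofReal_pow (norm_nonneg _), Real.norm_eq_abs, sq_abs]

lemma abs_exp_neg_sub_exp_neg_le {a b : ℝ} (ha : 0 ≤ a) (hb : 0 ≤ b) :
    |Real.exp (-a) - Real.exp (-b)| ≤ |a - b| := by
  wlog hab : a ≤ b generalizing a b
  · rw [abs_sub_comm, abs_sub_comm a]
    exact this hb ha (le_of_not_ge hab)
  have h1 : Real.exp (-b) = Real.exp (-a) * Real.exp (-(b - a)) := by
    rw [← Real.exp_add]; ring_nf
  have h2 := Real.add_one_le_exp (-(b - a))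
  have h3 : Real.exp (-(b - a)) ≤ 1 := Real.exp_le_one_iff.2 (by linarith)
  have h4 : Real.exp (-a) ≤ 1 := Real.exp_le_one_iff.2 (by linarith)
  have h5 := Real.exp_pos (-a)
  rw [h1, abs_sub_comm a, abs_of_nonneg (by linarith : 0 ≤ b - a), abs_le]
  constructor <;> nlinarith

lemma norm_integral_exp_sub_integral_exp_le {α : Type*} [MeasurableSpace α] {m : Measure α}
    [IsProbabilityMeasure m] {S T : α → ℝ} (hS : Measurable S) (hT : Measurable T)
    (hd : MemLp (fun x => S x - T x) 2 m) (s : ℝ) :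
    ‖∫ x, Complex.exp (((s * S x : ℝ) : ℂ) * Complex.I) ∂m -
      ∫ x, Complex.exp (((s * T x : ℝ) : ℂ) * Complex.I) ∂m‖ ≤
      |s| * (eLpNorm (fun x => S x - T x) 2 m).toReal := by
  have hi : ∀ {R : α → ℝ}, Measurable R →
      Integrable (fun x => Complex.exp (((s * R x : ℝ) : ℂ) * Complex.I)) m := fun {R} hR =>
    .of_bound (Measurable.aestronglyMeasurable (by fun_prop)) 1
      (.of_forall fun x => (Complex.norm_exp_ofReal_mul_I _).le)
  rw [← integral_sub (hi hS) (hi hT)]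
  have h1 : ∀ x, ‖Complex.exp (((s * S x : ℝ) : ℂ) * Complex.I) -
      Complex.exp (((s * T x : ℝ) : ℂ) * Complex.I)‖ ≤ |s| * |S x - T x| := by
    intro x
    have e : Complex.exp (((s * S x : ℝ) : ℂ) * Complex.I) -
        Complex.exp (((s * T x : ℝ) : ℂ) * Complex.I) =
        Complex.exp (((s * T x : ℝ) : ℂ) * Complex.I) *
          (Complex.exp (Complex.I * ((s * (S x - T x) : ℝ) : ℂ)) - 1) := by
      rw [mul_sub, ← Complex.exp_add, mul_one]
      congr 2
      push_cast; ring
    rw [e, norm_mul, Complex.norm_exp_ofReal_mul_I, one_mul, ← abs_mul]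
    exact Real.norm_exp_I_mul_ofReal_sub_one_le
  have h2 : Integrable (fun x => |S x - T x|) m := (hd.integrable one_le_two).abs
  refine (norm_integral_le_of_norm_le (h2.const_mul |s|) (.of_forall h1)).trans ?_
  rw [integral_const_mul]
  refine mul_le_mul_of_nonneg_left ?_ (abs_nonneg _)
  have h3 := (le_abs_self _).trans (abs_integral_mul_le hd.abs (memLp_const (1 : ℝ)))
  have h4 : eLpNorm (fun x => |S x - T x|) 2 m = eLpNorm (fun x => S x - T x) 2 m :=
    eLpNorm_norm (fun x => S x - T x)
  have h5 : eLpNorm |fun x => S x - T x| 2 m = eLpNorm (fun x => S x - T x) 2 m := h4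
  rw [eLpNorm_const _ two_ne_zero (NeZero.ne _), h5] at h3
  simpa using h3

variable {ι E : Type*} [AddCommGroup ι] [MeasurableSpace E] {ν : Measure E}
  [IsProbabilityMeasure ν] {f : (ι → E) → ℝ}

lemma memLp_siteSum (hf : MemLp f 2 (iidLaw ι ν)) (Γ : Finset ι) :
    MemLp (siteSum f Γ) 2 (iidLaw ι ν) :=
  memLp_finsetSum _ fun i _ => hf.comp_measurePreserving (measurePreserving_translate i)

lemma integral_siteSum_eq_zero (hf : MemLp f 2 (iidLaw ι ν))
    (hf0 : ∫ x, f x ∂iidLaw ι ν = 0) (Γ : Finset ι) :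
    ∫ x, siteSum f Γ x ∂iidLaw ι ν = 0 := by
  have hi : ∀ i, Integrable (fun x => f (translate i x)) (iidLaw ι ν) := fun i =>
    (hf.comp_measurePreserving (measurePreserving_translate i)).integrable one_le_two
  simp only [siteSum]
  rw [integral_finsetSum _ fun i _ => hi i]
  refine Finset.sum_eq_zero fun i _ => ?_
  rw [integral_comp_measurePreserving (measurePreserving_translate i) hf.1, hf0]

/-- The `L²` norm of a sum over `Γ` is at most `√|Γ|` times the total influence. -/
lemma toReal_eLpNorm_siteSum_le [Countable ι] (hfm : Measurable f) (hf : MemLp f 2 (iidLaw ι ν))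
    (hf0 : ∫ x, f x ∂iidLaw ι ν = 0) (hsum : ∑' k, influence ν f k ≠ ∞) (Γ : Finset ι) :
    (eLpNorm (siteSum f Γ) 2 (iidLaw ι ν)).toReal ≤
      √Γ.card * (∑' k, influence ν f k).toReal := by
  have h := variance_sum_le (ν := ν) (f := fun i => f ∘ translate i) (b := influence ν f)
    (fun i => hfm.comp (measurable_translate i))
    (fun i => hf.comp_measurePreserving (measurePreserving_translate i))
    (fun i k => (influence_comp_translate hfm i k).le) Γ
  have hS := memLp_siteSum hf Γ
  have hv : Var[siteSum f Γ; iidLaw ι ν] = (eLpNorm (siteSum f Γ) 2 (iidLaw ι ν)).toReal ^ 2 := by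
    rw [toReal_eLpNorm_two_sq hS, variance_of_integral_eq_zero hS.1.aemeasurable
      (integral_siteSum_eq_zero hf hf0 Γ)]
  refine abs_le_of_sq_le_sq' ?_ (by positivity) |>.2
  rw [← hv, mul_pow, Real.sq_sqrt (by positivity)]
  have h' : ENNReal.ofReal (Var[siteSum f Γ; iidLaw ι ν]) ≤
      Γ.card * (∑' k, influence ν f k) ^ 2 := h
  have := ENNReal.toReal_mono (by finiteness) h'
  rwa [ENNReal.toReal_ofReal (variance_nonneg _ _), ENNReal.toReal_mul, ENNReal.toReal_natCast,
    ENNReal.toReal_pow] at this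

/-- Central limit theorem at the level of characteristic functions, for a centred field with
summable influences: the field is approximated, uniformly over `Γ`, by bounded fields of finite
range. -/
lemma tendsto_charFun_siteSum_sub [Countable ι] (hfm : Measurable f)
    (hf : MemLp f 2 (iidLaw ι ν)) (hf0 : ∫ x, f x ∂iidLaw ι ν = 0)
    (hsum : ∑' k, influence ν f k ≠ ∞) {Γ : ℕ → Finset ι}
    (hΓ : Tendsto (fun n => (Γ n).card) atTop atTop) (t : ℝ) :
    Tendsto (fun n =>
      ∫ x, Complex.exp (((t / √(Γ n).card * siteSum f (Γ n) x : ℝ) : ℂ) * Complex.I) ∂iidLaw ι ν -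
        (Real.exp (-((∫ x, siteSum f (Γ n) x ^ 2 ∂iidLaw ι ν) / (Γ n).card * t ^ 2 / 2)) : ℂ))
      atTop (𝓝 0) := by
  set Δ := (∑' k, influence ν f k).toReal with hΔ
  have hΔ0 : 0 ≤ Δ := ENNReal.toReal_nonneg
  rw [NormedAddGroup.tendsto_nhds_zero]
  intro δ hδ
  -- `L * η` bounds the cost of replacing `f` by an approximation with total influence error `η`.
  set L := |t| + t ^ 2 / 2 * (2 * Δ + 1) + 1 with hL
  have hL0 : 0 < L := by positivity
  set η := min 1 (δ / 2 / L) with hη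
  have hη0 : 0 < η := by positivity
  have hη1 : η ≤ 1 := min_le_left _ _
  have hηL : η * L ≤ δ / 2 := by
    rw [← le_div_iff₀ hL0]
    exact min_le_right _ _
  obtain ⟨A, h, M, hhm, hhA, hhM, hh0, hhη⟩ :=
    exists_bounded_local_approx_influence hfm hf hf0 hsum hη0
  obtain ⟨C, hC⟩ := exists_norm_charFun_siteSum_sub_le (ν := ν) hhm hhA hhM hh0
  have hh2 : MemLp h 2 (iidLaw ι ν) := .of_bound hhm.aestronglyMeasurable M (.of_forall hhM)
  have hlim : Tendsto (fun n => C * (|t| ^ 3 + t ^ 2) / √((Γ n).card : ℝ)) atTop (𝓝 0) :=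
    Tendsto.const_div_atTop
      (Real.tendsto_sqrt_atTop.comp (tendsto_natCast_atTop_atTop.comp hΓ)) _
  filter_upwards [hlim.eventually_lt_const (half_pos hδ), hΓ.eventually_ge_atTop 1]
    with n hn hn1
  set N : ℝ := ((Γ n).card : ℝ) with hN
  have hN0 : 0 < N := by
    rw [hN]; exact_mod_cast hn1
  have hsN : 0 < √N := Real.sqrt_pos.2 hN0
  have hsN2 : √N ^ 2 = N := Real.sq_sqrt hN0.le
  set s := t / √N with hs
  set S := siteSum f (Γ n) with hS
  set T := siteSum h (Γ n) with hT
  have hS2 : MemLp S 2 (iidLaw ι ν) := memLp_siteSum hf _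
  have hT2 : MemLp T 2 (iidLaw ι ν) := memLp_siteSum hh2 _
  set a := (eLpNorm S 2 (iidLaw ι ν)).toReal with ha
  set b := (eLpNorm (fun x => S x - T x) 2 (iidLaw ι ν)).toReal with hb
  have hb0 : 0 ≤ b := ENNReal.toReal_nonneg
  have ha0 : 0 ≤ a := ENNReal.toReal_nonneg
  have haN : a ≤ √N * Δ := toReal_eLpNorm_siteSum_le hfm hf hf0 hsum _
  have hbN : b ≤ √N * η := by
    have h1 := toReal_eLpNorm_siteSum_le (f := fun x => f x - h x) (ν := ν) (hfm.sub hhm)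
      (hf.sub hh2) (by
        rw [integral_sub (hf.integrable one_le_two) (hh2.integrable one_le_two), hf0, hh0,
          sub_zero]) (hhη.trans_lt ENNReal.ofReal_lt_top).ne (Γ n)
    have e : siteSum (fun x => f x - h x) (Γ n) = fun x => S x - T x :=
      funext fun x => siteSum_sub f h (Γ n) x
    rw [e] at h1
    refine h1.trans (mul_le_mul_of_nonneg_left ?_ hsN.le)
    exact ENNReal.toReal_le_of_le_ofReal hη0.le hhη
  set V := ∫ x, S x ^ 2 ∂iidLaw ι ν with hV
  set V' := ∫ x, T x ^ 2 ∂iidLaw ι ν with hV'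
  have hV0 : 0 ≤ V := integral_nonneg fun x => sq_nonneg _
  have hV'0 : 0 ≤ V' := integral_nonneg fun x => sq_nonneg _
  have hVV : |V' - V| ≤ N * (η * (2 * Δ + 1)) := by
    have hd : MemLp (fun x => S x - T x) 2 (iidLaw ι ν) := hS2.sub hT2
    have h1 : V' - V = (∫ x, (S x - T x) * (S x - T x) ∂iidLaw ι ν) -
        2 * ∫ x, S x * (S x - T x) ∂iidLaw ι ν := by
      have i1 : Integrable (fun x => (S x - T x) * (S x - T x)) (iidLaw ι ν) :=
        hd.integrable_mul hd
      have i2 : Integrable (fun x => S x * (S x - T x)) (iidLaw ι ν) := hS2.integrable_mul hd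
      rw [hV, hV', ← integral_sub hT2.integrable_sq hS2.integrable_sq, ← integral_const_mul,
        ← integral_sub i1 (i2.const_mul 2)]
      refine integral_congr_ae (.of_forall fun x => ?_)
      dsimp only
      ring
    have h2 := abs_integral_mul_le hd hd
    have h3 := abs_integral_mul_le hS2 hd
    rw [← hb] at h2 h3
    rw [← ha] at h3
    have h4 : |V' - V| ≤ b * b + 2 * (a * b) := by
      rw [h1]
      refine (abs_sub _ _).trans ?_
      rw [abs_mul, abs_two]
      linarith
    have h5 : b * b ≤ (√N * η) * (√N * 1) :=
      mul_le_mul hbN (hbN.trans (by gcongr)) hb0 (by positivity)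
    have h6 : a * b ≤ (√N * Δ) * (√N * η) := mul_le_mul haN hbN hb0 (by positivity)
    calc _ ≤ (√N * η) * (√N * 1) + 2 * ((√N * Δ) * (√N * η)) := by linarith
      _ = √N ^ 2 * (η * (2 * Δ + 1)) := by ring
      _ = _ := by rw [hsN2]
  have hsabs : |s| * √N = |t| := by
    rw [hs, abs_div, abs_of_pos hsN, div_mul_cancel₀ _ hsN.ne']
  have hs2 : s ^ 2 * N = t ^ 2 := by
    rw [hs, div_pow, hsN2, div_mul_cancel₀ _ hN0.ne']
  have e1 : V / N * t ^ 2 / 2 = V * s ^ 2 / 2 := by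
    rw [← hs2]; field_simp
  have b1 : ‖∫ x, Complex.exp (((s * S x : ℝ) : ℂ) * Complex.I) ∂iidLaw ι ν -
      ∫ x, Complex.exp (((s * T x : ℝ) : ℂ) * Complex.I) ∂iidLaw ι ν‖ ≤ |t| * η := by
    refine (norm_integral_exp_sub_integral_exp_le (measurable_siteSum hfm)
      (measurable_siteSum hhm) (hS2.sub hT2) s).trans ?_
    rw [← hsabs, mul_assoc]
    exact mul_le_mul_of_nonneg_left hbN (abs_nonneg _)
  have b2 : ‖∫ x, Complex.exp (((s * T x : ℝ) : ℂ) * Complex.I) ∂iidLaw ι ν -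
      (Real.exp (-(V' * s ^ 2 / 2)) : ℝ)‖ < δ / 2 := by
    refine (hC (Γ n) s).trans_lt (lt_of_eq_of_lt ?_ hn)
    have h1 : N * |s| ^ 3 = |t| ^ 3 / √N := by
      rw [← hsabs, eq_div_iff hsN.ne']
      nth_rewrite 1 [← hsN2]
      ring
    have h2 : √N * s ^ 2 = t ^ 2 / √N := by
      rw [← hs2, eq_div_iff hsN.ne']
      nth_rewrite 3 [← hsN2]
      ring
    rw [← hN, h1, h2]
    ring
  have b3 : ‖((Real.exp (-(V' * s ^ 2 / 2)) : ℝ) : ℂ) - (Real.exp (-(V * s ^ 2 / 2)) : ℝ)‖ ≤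
      t ^ 2 / 2 * (η * (2 * Δ + 1)) := by
    rw [← Complex.ofReal_sub, Complex.norm_real, Real.norm_eq_abs]
    refine (abs_exp_neg_sub_exp_neg_le (by positivity) (by positivity)).trans ?_
    have : V' * s ^ 2 / 2 - V * s ^ 2 / 2 = (V' - V) * (s ^ 2 / 2) := by ring
    rw [this, abs_mul, abs_of_nonneg (by positivity : 0 ≤ s ^ 2 / 2)]
    calc _ ≤ N * (η * (2 * Δ + 1)) * (s ^ 2 / 2) := by gcongr
      _ = (s ^ 2 * N) / 2 * (η * (2 * Δ + 1)) := by ring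
      _ = _ := by rw [hs2]
  rw [e1]
  set c₁ := ∫ x, Complex.exp (((s * S x : ℝ) : ℂ) * Complex.I) ∂iidLaw ι ν
  set c₂ := ∫ x, Complex.exp (((s * T x : ℝ) : ℂ) * Complex.I) ∂iidLaw ι ν
  have e2 : c₁ - (Real.exp (-(V * s ^ 2 / 2)) : ℝ) = (c₁ - c₂) +
      (c₂ - (Real.exp (-(V' * s ^ 2 / 2)) : ℝ)) +
      (((Real.exp (-(V' * s ^ 2 / 2)) : ℝ) : ℂ) - (Real.exp (-(V * s ^ 2 / 2)) : ℝ)) := by ring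
  rw [e2]
  refine (norm_add₃_le).trans_lt ?_
  have : |t| * η + t ^ 2 / 2 * (η * (2 * Δ + 1)) ≤ η * L := by
    rw [hL]; nlinarith
  linarith

end SummableInfluence

/-! ### The Lévy distance and weak convergence -/

section LevyDistance

variable {ν₁ ν₂ : Measure ℝ}

lemma levyDist_nonneg : 0 ≤ levyDist ν₁ ν₂ :=
  Real.sInf_nonneg fun _ hr => hr.1.le

variable [IsProbabilityMeasure ν₁] [IsProbabilityMeasure ν₂]

lemma levyDist_le_levyProkhorovDist : levyDist ν₁ ν₂ ≤ levyProkhorovDist ν₁ ν₂ := by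
  refine le_of_forall_gt_imp_ge_of_dense fun r hr => ?_
  have hr0 : 0 < r := ENNReal.toReal_nonneg.trans_lt hr
  have hlt : levyProkhorovEDist ν₁ ν₂ < ENNReal.ofReal r :=
    (ENNReal.lt_ofReal_iff_toReal_lt (levyProkhorovEDist_ne_top _ _)).2 hr
  have hth : ∀ x : ℝ, Metric.thickening r (Set.Iic x) ⊆ Set.Iic (x + r) := by
    intro x y hy
    obtain ⟨z, hz, hyz⟩ := Metric.mem_thickening_iff.1 hy
    have := (abs_lt.1 (Real.dist_eq y z ▸ hyz)).2
    simp only [Set.mem_Iic] at hz ⊢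
    linarith
  have hreal : ∀ {m₁ m₂ : Measure ℝ} [IsProbabilityMeasure m₁] [IsProbabilityMeasure m₂] (x : ℝ),
      m₁ (Set.Iic x) ≤ m₂ (Metric.thickening (ENNReal.ofReal r).toReal (Set.Iic x)) +
        ENNReal.ofReal r → cdf m₁ x ≤ cdf m₂ (x + r) + r := by
    intro m₁ m₂ _ _ x h
    rw [ENNReal.toReal_ofReal hr0.le] at h
    have h1 := h.trans (add_le_add (measure_mono (hth x)) le_rfl)
    rw [cdf_eq_real, cdf_eq_real, measureReal_def, measureReal_def]
    refine (ENNReal.toReal_mono (by finiteness) h1).trans (le_of_eq ?_)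
    rw [ENNReal.toReal_add (by finiteness) (by finiteness), ENNReal.toReal_ofReal hr0.le]
  refine csInf_le ⟨0, fun r hr => hr.1.le⟩ ⟨hr0, fun x => ⟨?_, ?_⟩⟩
  · have := hreal (x - r)
      (left_measure_le_of_levyProkhorovEDist_lt hlt (measurableSet_Iic (a := x - r)))
    rw [sub_add_cancel] at this
    linarith
  · exact hreal x (right_measure_le_of_levyProkhorovEDist_lt hlt measurableSet_Iic)

lemma tendsto_levyDist_zero {μs νs : ℕ → ProbabilityMeasure ℝ} {ρ : ProbabilityMeasure ℝ}
    (hμ : Tendsto μs atTop (𝓝 ρ)) (hν : Tendsto νs atTop (𝓝 ρ)) :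
    Tendsto (fun n => levyDist (μs n : Measure ℝ) (νs n : Measure ℝ)) atTop (𝓝 0) := by
  have hc := LevyProkhorov.continuous_ofMeasure_probabilityMeasure (Ω := ℝ)
  have h := ((hc.tendsto ρ).comp hμ).dist ((hc.tendsto ρ).comp hν)
  rw [dist_self] at h
  exact squeeze_zero (fun n => levyDist_nonneg) (fun n => levyDist_le_levyProkhorovDist) h

/-- Laws whose characteristic functions asymptotically agree with those of centred Gaussian laws of
bounded variance are asymptotically close to these Gaussian laws in Lévy distance. -/
lemma tendsto_levyDist_gaussianReal {μs : ℕ → Measure ℝ} [∀ n, IsProbabilityMeasure (μs n)]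
    {v : ℕ → ℝ} {c : ℝ} (hv0 : ∀ n, 0 ≤ v n) (hvc : ∀ n, v n ≤ c)
    (h : ∀ t : ℝ, Tendsto (fun n => charFun (μs n) t - (Real.exp (-(v n * t ^ 2 / 2)) : ℂ))
      atTop (𝓝 0)) :
    Tendsto (fun n => levyDist (μs n) (gaussianReal 0 (v n).toNNReal)) atTop (𝓝 0) := by
  -- The variances may oscillate or degenerate; along a subsequence they converge to some `w`, and
  -- both sequences of laws then converge weakly to the Gaussian law of variance `w`.
  refine tendsto_of_subseq_tendsto fun ns hns => ?_
  obtain ⟨w, -, φ, hφ, hw⟩ := tendsto_subseq_of_bounded (Metric.isBounded_Icc 0 c)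
    (x := fun n => v (ns n)) fun n => ⟨hv0 _, hvc _⟩
  refine ⟨φ, ?_⟩
  have hw0 : 0 ≤ w := ge_of_tendsto' hw fun n => hv0 _
  have hgauss : ∀ u : ℝ, 0 ≤ u → ∀ t : ℝ, charFun (gaussianReal 0 u.toNNReal) t =
      (Real.exp (-(u * t ^ 2 / 2)) : ℂ) := by
    intro u hu t
    rw [charFun_gaussianReal]
    push_cast [Real.coe_toNNReal u hu]
    congr 1
    ring
  have hexp : ∀ t : ℝ, Tendsto (fun n => (Real.exp (-(v (ns (φ n)) * t ^ 2 / 2)) : ℂ)) atTop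
      (𝓝 (Real.exp (-(w * t ^ 2 / 2)) : ℂ)) := by
    intro t
    have hc : Continuous fun u : ℝ => (Real.exp (-(u * t ^ 2 / 2)) : ℂ) := by fun_prop
    exact (hc.tendsto w).comp hw
  refine tendsto_levyDist_zero (μs := fun n => ⟨μs (ns (φ n)), inferInstance⟩)
    (νs := fun n => ⟨gaussianReal 0 (v (ns (φ n))).toNNReal, inferInstance⟩)
    (ρ := ⟨gaussianReal 0 w.toNNReal, inferInstance⟩)
    (ProbabilityMeasure.tendsto_of_tendsto_charFun fun t => ?_)
    (ProbabilityMeasure.tendsto_of_tendsto_charFun fun t => ?_)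
  · have h1 := ((h t).comp (hns.comp hφ.tendsto_atTop)).add (hexp t)
    simpa [hgauss w hw0 t] using h1
  · simpa [hgauss w hw0 t, hgauss _ (hv0 _) t] using hexp t

end LevyDistance

/-! ### From the random field to the product space -/

section Coupling

variable {d : ℕ} {Ω E : Type*} {g : ((Fin d → ℤ) → E) → ℝ} {ε ε' : (Fin d → ℤ) → Ω → E}

/-- The function of the inputs whose translates make up the random field. -/
def seed (g : ((Fin d → ℤ) → E) → ℝ) (x : (Fin d → ℤ) → E) : ℝ := g fun s => x (-s)

lemma field_eq_seed (i : Fin d → ℤ) (ω : Ω) :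
    field g ε i ω = seed g (translate i fun j => ε j ω) := by
  simp only [field, seed, translate, sub_eq_add_neg]

lemma field_zero_eq_seed_comp : field g ε 0 = seed g ∘ fun ω j => ε j ω := by
  funext ω
  rw [field_eq_seed, translate_zero, Function.comp_apply]

variable [MeasurableSpace Ω] [MeasurableSpace E] {μ : Measure Ω}

lemma measurable_seed (hg : Measurable g) : Measurable (seed g) :=
  hg.comp (measurable_pi_iff.2 fun _ => measurable_pi_apply _)

lemma measurePreserving_iid (hε : IsIID ε μ) :
    MeasurePreserving (fun ω j => ε j ω) μ (iidLaw (Fin d → ℤ) (μ.map (ε 0))) := by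
  obtain ⟨hm, hi, hid⟩ := hε
  refine ⟨measurable_pi_iff.2 hm, ?_⟩
  rw [hi.map_fun_eq_infinitePi_map hm]
  congr 1
  funext j
  exact (hid j 0).map_eq

variable [IsProbabilityMeasure μ]

lemma measurePreserving_pair (hε : IsIID ε μ) (hε' : IsIndepCopy ε ε' μ) :
    MeasurePreserving (fun ω => ((fun j => ε j ω), fun j => ε' j ω)) μ
      (iidPair (Fin d → ℤ) (μ.map (ε 0))) := by
  have h := measurePreserving_iid hε
  obtain ⟨hm', hid, hind⟩ := hε'
  have hm : Measurable fun ω j => ε' j ω := measurable_pi_iff.2 hm'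
  refine ⟨h.measurable.prodMk hm, ?_⟩
  rw [hind.map_prod_eq_prod_map_map h.aemeasurable hm.aemeasurable, hid.map_eq, h.map_eq]

/-- The physical dependence measure at the site `i` is the influence of the coordinate `-i`. -/
lemma physicalDependence_eq_influence (hg : Measurable g) (hε : IsIID ε μ)
    (hε' : IsIndepCopy ε ε' μ) (i : Fin d → ℤ) :
    physicalDependence g ε ε' 2 μ i = influence (μ.map (ε 0)) (seed g) (-i) := by
  have := Measure.isProbabilityMeasure_map (μ := μ) (hε.1 0).aemeasurable
  have hs := (measurable_seed hg).comp (measurable_translate (E := E) i)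
  have hm : Measurable fun p : ((Fin d → ℤ) → E) × ((Fin d → ℤ) → E) =>
      (seed g ∘ translate i) p.1 - (seed g ∘ translate i) (splice {0} p.2 p.1) :=
    (hs.comp measurable_fst).sub (hs.comp (measurable_splice measurable_snd measurable_fst))
  rw [← zero_sub i, ← influence_comp_translate (measurable_seed hg) i 0, influence,
    ← eLpNorm_comp_measurePreserving hm.aestronglyMeasurable (measurePreserving_pair hε hε')]
  refine congrArg (eLpNorm · 2 μ) (funext fun ω => ?_)
  have e : (fun j => coupledInput ε ε' j ω) = splice {0} (fun j => ε' j ω) fun j => ε j ω := by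
    funext j
    by_cases hj : j = 0
    · subst hj
      rw [splice_singleton_self, coupledInput, Function.update_self]
    · rw [splice_singleton_of_ne hj, coupledInput, Function.update_of_ne hj]
  simp only [field_eq_seed, Function.comp_apply, e]

end Coupling

end RandomField

theorem theorem1 {d : ℕ} {Ω E : Type*} [MeasurableSpace Ω] [MeasurableSpace E]
    (μ : Measure Ω) [IsProbabilityMeasure μ]
    (g : ((Fin d → ℤ) → E) → ℝ) (hg : Measurable g)
    (ε ε' : (Fin d → ℤ) → Ω → E)
    (hε : RandomField.IsIID ε μ) (hε' : RandomField.IsIndepCopy ε ε' μ)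
    (hL2 : ∀ i, MemLp (RandomField.field g ε i) 2 μ)
    (hcentered : ∀ i, ∫ ω, RandomField.field g ε i ω ∂μ = 0)
    (hΔ : ∑' i, RandomField.physicalDependence g ε ε' 2 μ i < ∞)
    (Γ : ℕ → Finset (Fin d → ℤ))
    (hΓ : Tendsto (fun n => (Γ n).card) atTop atTop)
    (σsq : ℕ → ℝ)
    (hσsq : ∀ n, σsq n = ∫ ω, RandomField.partialSum (RandomField.field g ε) (Γ n) ω ^ 2 ∂μ)
    (hσ : Tendsto σsq atTop atTop) :
    Tendsto (fun n => RandomField.levyDist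
        (μ.map (fun ω => RandomField.partialSum (RandomField.field g ε) (Γ n) ω
          / √((Γ n).card : ℝ)))
        (gaussianReal 0 (σsq n / ((Γ n).card : ℝ)).toNNReal))
      atTop (𝓝 0) := by
  open RandomField in
  have := Measure.isProbabilityMeasure_map (μ := μ) (hε.1 0).aemeasurable
  set ν := μ.map (ε 0) with hν
  set f := seed g with hf
  have hX := measurePreserving_iid hε
  have hfm : Measurable f := measurable_seed hg
  have hfield : field g ε 0 = f ∘ fun ω j => ε j ω := field_zero_eq_seed_comp
  have hf2 : MemLp f 2 (iidLaw (Fin d → ℤ) ν) := by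
    rw [← hX.map_eq, memLp_map_measure_iff hfm.aestronglyMeasurable hX.aemeasurable, ← hfield]
    exact hL2 0
  have hf0 : ∫ x, f x ∂iidLaw (Fin d → ℤ) ν = 0 := by
    rw [← integral_comp_measurePreserving hX hf2.1, ← hcentered 0, hfield]
    rfl
  have hsum : ∑' k, influence ν f k ≠ ∞ := by
    rw [← (Equiv.neg (Fin d → ℤ)).tsum_eq]
    simp only [physicalDependence_eq_influence hg hε hε'] at hΔ
    exact hΔ.ne
  have hS : ∀ n ω, partialSum (field g ε) (Γ n) ω = siteSum f (Γ n) fun j => ε j ω := by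
    intro n ω
    simp only [partialSum, siteSum, field_eq_seed, hf]
  have hSm : ∀ n, Measurable (siteSum f (Γ n)) := fun n => measurable_siteSum hfm
  have hV : ∀ n, σsq n = ∫ x, siteSum f (Γ n) x ^ 2 ∂iidLaw (Fin d → ℤ) ν := by
    intro n
    rw [hσsq, ← integral_comp_measurePreserving hX (memLp_siteSum hf2 _).integrable_sq.1]
    simp only [hS]
  have hmeas : ∀ n, Measurable fun ω => partialSum (field g ε) (Γ n) ω / √((Γ n).card : ℝ) := by
    intro n
    simp only [hS]
    exact ((hSm n).comp hX.measurable).div_const _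
  have hprob : ∀ n, IsProbabilityMeasure
      (μ.map (fun ω => partialSum (field g ε) (Γ n) ω / √((Γ n).card : ℝ))) := fun n =>
    Measure.isProbabilityMeasure_map (hmeas n).aemeasurable
  refine tendsto_levyDist_gaussianReal (c := (∑' k, influence ν f k).toReal ^ 2)
    (fun n => ?_) (fun n => ?_) fun t => ?_
  · rw [hV]
    exact div_nonneg (integral_nonneg fun x => sq_nonneg _) (Nat.cast_nonneg _)
  · refine div_le_of_le_mul₀ (Nat.cast_nonneg _) (sq_nonneg _) ?_
    rw [hV, ← toReal_eLpNorm_two_sq (memLp_siteSum hf2 _)]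
    have h1 := pow_le_pow_left₀ ENNReal.toReal_nonneg
      (toReal_eLpNorm_siteSum_le hfm hf2 hf0 hsum (Γ n)) 2
    rw [mul_pow, Real.sq_sqrt (Nat.cast_nonneg _)] at h1
    linarith
  · refine (tendsto_charFun_siteSum_sub hfm hf2 hf0 hsum hΓ t).congr fun n => ?_
    rw [charFun_apply_real, integral_map (hmeas n).aemeasurable
      (Measurable.aestronglyMeasurable (by fun_prop)), hV,
      ← integral_comp_measurePreserving hX (F := fun x =>
        Complex.exp (((t / √((Γ n).card : ℝ) * siteSum f (Γ n) x : ℝ) : ℂ) * Complex.I))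
        (Measurable.aestronglyMeasurable (by have := hSm n; fun_prop))]
    congr 2
    funext ω
    rw [hS]
    congr 2
    push_cast
    ring
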